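/- Let $R$ be a monad on $Sets$ with unit $\eta$, and write $\mathrm{bind}(f)=\mu_{X'}\circ R(f):R(X)\to R(X')$ for $f:X\to R(X')$. Let $LM$ be a left module over $R$ with values in $Sets$: sets $LM(X)$ (functorial in $X$) with maps $\rho(f):LM(X)\to LM(X')$ for $f:X\to R(X')$ such that $\rho(\eta_X)=\mathrm{id}$ and, in diagrammatic order, $\rho(f)\rho(g)=\rho(f\,\mathrm{bind}(g))$. For $f=(f_1,\dots,f_n)\in R(\{1,\dots,m\})^n$ write $E(f_1/1,\dots,f_n/n)$ for $\mathrm{bind}(f)(E)$ or $\rho(f)(E)$. Let $Ob=\coprod_{n\ge 0}\prod_{i=0}^{n-1}LM(\{1,\dots,i\})$, and let $\widetilde{Ob}$ be the set of $(\Gamma,S,o)$ with $\Gamma\in Ob$ of length $n$, $S\in LM(\{1,\dots,n\})$, $o\in R(\{1,\dots,n\})$. Let $CC(R,LM)$ be the C-system (contextual category) with set of objects $Ob$, with $Hom((E_1,\dots,E_m),(T_1,\dots,T_n))=R(\{1,\dots,m\})^n$, composition by substitution, identities $(1,\dots,n)$, length $l(T_1,\dots,T_n)=n$, final object the empty sequence,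 $ft(T_1,\dots,T_{n+1})=(T_1,\dots,T_n)$, canonical projections $(1,\dots,n)$, and, for $f=(f_1,\dots,f_n):(E_1,\dots,E_m)\to(T_1,\dots,T_n)$, canonical pull-back $f^*(T_1,\dots,T_{n+1})=(E_1,\dots,E_m,T_{n+1}(f_1/1,\dots,f_n/n))$ with $q(f)=(f_1,\dots,f_n,m+1)$. A triple $(\Gamma,S,o)\in\widetilde{Ob}$ is identified with the section $(1,\dots,n,o):\Gamma\to(\Gamma,S)$ of the canonical projection; all sections of canonical projections of objects of positive length are of this form. Put $\partial(\Gamma,S,o)=(\Gamma,S)$. Let $C\subset Ob$, $\widetilde C\subset\widetilde{Ob}$, let $Ceq$ be a set of triples $(\Gamma,S,S')$ and $\widetilde{Ceq}$ a set of quadruples $(\Gamma,S,o,o')$ with $\Gamma\in Ob$ of length $n$, $S,S'\in LM(\{1,\dots,n\})$, $o,o'\in R(\{1,\dots,n\})$. Write $\Gamma\rhd$, $\Gamma\vdash o:S$, $\Gamma\vdash S=S'$, $\Gamma\vdash o=o':S$ for $\Gamma\in C$, $(\Gamma,S,o)\in\widetilde C$, $(\Gamma,S,S')\in Ceq$, $(\Gamma,S,o,o')\in\widetilde{Ceq}$.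 For $n=l(\Gamma)$ let $E\mapsto E^{\uparrow}$ be the renaming that fixes $1,\dots,n$ and sends each variable $j>n$ to $j+1$, and for $r\in R(\{1,\dots,n\})$ let $E\mapsto E[r]$ be the substitution that fixes $1,\dots,n$, sends $n+1$ to $r$ and each $j>n+1$ to $j-1$; both are also applied componentwise to sequences $\Delta$. Inclusions $LM(\{1,\dots,n\})\to LM(\{1,\dots,n+1\})$ are suppressed. Assume: 1. (C-subsystem conditions) the empty sequence is in $C$; $(\Gamma,T\rhd)\Rightarrow(\Gamma\rhd)$; $(\Gamma\vdash r:S)\Rightarrow(\Gamma,S\rhd)$; $(\Gamma,T\rhd)\wedge(\Gamma,\Delta\vdash r:S)\Rightarrow(\Gamma,T,\Delta^\uparrow\vdash r^\uparrow:S^\uparrow)$; $(\Gamma\vdash s:S)\wedge(\Gamma,S,\Delta\vdash r:T)\Rightarrow(\Gamma,\Delta[s]\vdash r[s]:T[s])$; $(\Gamma,T\rhd)\Rightarrow(\Gamma,T\vdash n+1:T)$, where $n=l(\Gamma)$. 2. $(\Gamma\vdash T=T')\Rightarrow(\Gamma,T\rhd)$; $(\Gamma,T\rhd)\Rightarrow(\Gamma\vdash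 T=T)$; $\Gamma\vdash T=T'$ is symmetric and transitive in $T,T'$. 3. $(\Gamma\vdash o=o':T)\Rightarrow(\Gamma\vdash o:T)$; $(\Gamma\vdash o:T)\Rightarrow(\Gamma\vdash o=o:T)$; $\Gamma\vdash o=o':T$ is symmetric and transitive in $o,o'$. 4. $(\Gamma\vdash T=T')\wedge(\Gamma,T,\Delta\vdash S=S')\Rightarrow(\Gamma,T',\Delta\vdash S=S')$; $(\Gamma\vdash T=T')\wedge(\Gamma,T,\Delta\vdash o=o':S)\Rightarrow(\Gamma,T',\Delta\vdash o=o':S)$; $(\Gamma\vdash S=S')\wedge(\Gamma\vdash o=o':S)\Rightarrow(\Gamma\vdash o=o':S')$. 5. If $\Gamma,T\rhd$, then $(\Gamma,\Delta\vdash S=S')\Rightarrow(\Gamma,T,\Delta^\uparrow\vdash S^\uparrow=S'^\uparrow)$ and $(\Gamma,\Delta\vdash o=o':S)\Rightarrow(\Gamma,T,\Delta^\uparrow\vdash o^\uparrow=o'^\uparrow:S^\uparrow)$. 6. If $\Gamma\vdash r:T$, then $(\Gamma,T,\Delta\vdash S=S')\Rightarrow(\Gamma,\Delta[r]\vdash S[r]=S'[r])$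 and $(\Gamma,T,\Delta\vdash o=o':S)\Rightarrow(\Gamma,\Delta[r]\vdash o[r]=o'[r]:S[r])$. 7. If $\Gamma\vdash r=r':T$, then $(\Gamma,T,\Delta,S\rhd)\Rightarrow(\Gamma,\Delta[r]\vdash S[r]=S[r'])$ and $(\Gamma,T,\Delta\vdash o:S)\Rightarrow(\Gamma,\Delta[r]\vdash o[r]=o[r']:S[r])$. Define $\sim$ on $C$: the empty sequence is related to itself, $(\Gamma,T)\sim(\Gamma',T')$ iff $\Gamma\sim\Gamma'$ and $\Gamma\vdash T=T'$, and sequences of different lengths are not related. Define $\simeq$ on $\widetilde C$: $(\Gamma\vdash o:S)\simeq(\Gamma'\vdash o':S')$ iff $(\Gamma,S)\sim(\Gamma',S')$ and $\Gamma\vdash o=o':S$. Then: (i) $\sim$ and $\simeq$ are equivalence relations on $C$ and $\widetilde C$. (ii) They are compatible with $ft$, $\partial$ and with the operations $T:((\Gamma,T),(\Gamma,\Delta))\mapsto(\Gamma,T,\Delta^\uparrow)$, $\widetilde T:((\Gamma,T),(\Gamma,\Delta\vdash o:S))\mapsto(\Gamma,T,\Delta^\uparrow\vdash o^\uparrow:S^\uparrow)$,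 $S:((\Gamma\vdash r:T),(\Gamma,T,\Delta))\mapsto(\Gamma,\Delta[r])$, $\widetilde S:((\Gamma\vdash r:T),(\Gamma,T,\Delta\vdash o:S))\mapsto(\Gamma,\Delta[r]\vdash o[r]:S[r])$, $\delta:(\Gamma,T)\mapsto(\Gamma,T\vdash n+1:T)$; $\sim$ preserves lengths; if $X,F\in C$, $l(X)>0$ and $ft(X)\sim F$, there is $X'\in C$ with $X\sim X'$ and $ft(X')=F$; if $J\in\widetilde C$, $F\in C$ and $\partial(J)\sim F$, there is $J'\in\widetilde C$ with $J\simeq J'$ and $\partial(J')=F$. (iii) There is a unique C-subsystem $CC$ of $CC(R,LM)$ whose set of objects is $C$ and whose set of sections of canonical projections of objects of positive length is $\widetilde C$, and there is a unique regular congruence relation on $CC$ whose restrictions to objects and to these sections are $\sim$ and $\simeq$. Here a C-subsystem is a sub-(pre)category closed under all operations of the C-system, including the operation sending $f:Y\to X$ with $l(X)>0$ to the section $s_f$ of the canonical projection of $(p_X\circ f)^*X$ with $q(p_X\circ f,X)\circ s_f=f$. A regular congruence relation is a pair of equivalence relations on objects and on morphisms, compatible with domain, codomain, identities, composition, $ft$,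 $p_X$, $f^*X$, $q(f,X)$ and $s_f$, such that equivalent objects have the same length; if $l(X)>0$ and $ft(X)$ is equivalent to $F$, then $X$ is equivalent to some $X_F$ with $ft(X_F)=F$; and for each $f:X\to Y$ and $X',Y'$ equivalent to $X,Y$ there is $f':X'\to Y'$ equivalent to $f$. -/

import Mathlib

universe u

namespace ModCSys

open CategoryTheory

/-! # C-systems -/

/-- A C-system, as a pre-category: a set of objects, a set of morphisms with domain and
codomain maps, identities and a composition written in diagrammatic order, together with the
length function `l`, the object `pt`, the map `ft`, the canonical projections `p X : X ⟶ ft X`,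
the canonical squares given by `pull X f = f^* X` and `q X f : f^* X ⟶ X` for `f : Y ⟶ ft X`,
`0 < l X`, and the operation `s` sending `f : Y ⟶ X`, `0 < l X`, to the section `s f` of the
canonical projection of `(f ≫ p X)^* X` (such an operation is equivalent to the canonical squares
being pull-back squares). -/
structure CSystem where
  Ob : Type u
  Mor : Type u
  dom : Mor → Ob
  cod : Mor → Ob
  id : Ob → Mor
  comp : (f g : Mor) → cod f = dom g → Mor
  dom_id : ∀ X, dom (id X) = X
  cod_id : ∀ X, cod (id X) = X
  dom_comp : ∀ f g h, dom (comp f g h) = dom f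
  cod_comp : ∀ f g h, cod (comp f g h) = cod g
  id_comp : ∀ f h, comp (id (dom f)) f h = f
  comp_id : ∀ f h, comp f (id (cod f)) h = f
  assoc : ∀ f g k h₁ h₂ h₃ h₄, comp (comp f g h₁) k h₂ = comp f (comp g k h₃) h₄
  l : Ob → ℕ
  pt : Ob
  ft : Ob → Ob
  p : Ob → Mor
  pull : (X : Ob) → (f : Mor) → 0 < l X → cod f = ft X → Ob
  q : (X : Ob) → (f : Mor) → 0 < l X → cod f = ft X → Mor
  s : (f : Mor) → 0 < l (cod f) → Mor
  l_eq_zero : ∀ X, l X = 0 ↔ X = pt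
  l_ft : ∀ X, 0 < l X → l (ft X) + 1 = l X
  ft_pt : ft pt = pt
  final : ∀ X, ∃! f, dom f = X ∧ cod f = pt
  dom_p : ∀ X, dom (p X) = X
  cod_p : ∀ X, cod (p X) = ft X
  l_pull : ∀ X f h hf, 0 < l (pull X f h hf)
  ft_pull : ∀ X f h hf, ft (pull X f h hf) = dom f
  dom_q : ∀ X f h hf, dom (q X f h hf) = pull X f h hf
  cod_q : ∀ X f h hf, cod (q X f h hf) = X
  q_comm : ∀ X f h hf h₁ h₂,
    comp (q X f h hf) (p X) h₁ = comp (p (pull X f h hf)) f h₂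
  pull_id : ∀ X h hf, pull X (id (ft X)) h hf = X
  q_id : ∀ X h hf, q X (id (ft X)) h hf = id X
  pull_comp : ∀ X f g hgf h h₁ h₂ h₃ h₄,
    pull X (comp g f hgf) h h₁ = pull (pull X f h h₂) g h₃ h₄
  q_comp : ∀ X f g hgf h h₁ h₂ h₃ h₄ h₅,
    q X (comp g f hgf) h h₁ = comp (q (pull X f h h₂) g h₃ h₄) (q X f h h₂) h₅
  dom_s : ∀ f h, dom (s f h) = dom f
  cod_s : ∀ f h h₁ h₂, cod (s f h) = pull (cod f) (comp f (p (cod f)) h₁) h h₂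
  s_p : ∀ f h h₁, comp (s f h) (p (cod (s f h))) h₁ = id (dom f)
  s_q : ∀ f h h₁ h₂ h₃,
    comp (s f h) (q (cod f) (comp f (p (cod f)) h₁) h h₂) h₃ = f
  s_pull : ∀ f U g hU hg h h₁ h₂,
    cod f = pull U g hU hg → s f h = s (comp f (q U g hU hg) h₁) h₂

/-- The sections of the canonical projections: morphisms `s : ft X ⟶ X` with `0 < l X` and
`s ≫ p X = id (ft X)`. -/
def CSystem.sections (A : CSystem.{u}) : Set A.Mor :=
  {s | 0 < A.l (A.cod s) ∧ A.dom s = A.ft (A.cod s) ∧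
    ∃ h, A.comp s (A.p (A.cod s)) h = A.id (A.ft (A.cod s))}

/-- A C-subsystem: a sub-pre-category closed under the operations of the C-system. -/
@[ext]
structure CSubsystem (A : CSystem.{u}) where
  ob : Set A.Ob
  mor : Set A.Mor
  dom_mem : ∀ f ∈ mor, A.dom f ∈ ob
  cod_mem : ∀ f ∈ mor, A.cod f ∈ ob
  id_mem : ∀ X ∈ ob, A.id X ∈ mor
  comp_mem : ∀ f ∈ mor, ∀ g ∈ mor, ∀ h, A.comp f g h ∈ mor
  pt_mem : A.pt ∈ ob
  ft_mem : ∀ X ∈ ob, A.ft X ∈ ob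
  p_mem : ∀ X ∈ ob, A.p X ∈ mor
  pull_mem : ∀ X ∈ ob, ∀ f ∈ mor, ∀ h hf, A.pull X f h hf ∈ ob
  q_mem : ∀ X ∈ ob, ∀ f ∈ mor, ∀ h hf, A.q X f h hf ∈ mor
  s_mem : ∀ f ∈ mor, ∀ h, A.s f h ∈ mor

theorem CSubsystem.exists_final {A : CSystem.{u}} (D : CSubsystem A) (n : ℕ) :
    ∀ X ∈ D.ob, A.l X = n → ∃ f ∈ D.mor, A.dom f = X ∧ A.cod f = A.pt := by
  induction n with
  | zero =>
    intro X hX h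
    have : X = A.pt := (A.l_eq_zero X).1 h
    exact ⟨A.id X, D.id_mem X hX, A.dom_id X, (A.cod_id X).trans this⟩
  | succ n ih =>
    intro X hX h
    have h1 := A.l_ft X (by omega)
    obtain ⟨f, hf, hd, hc⟩ := ih (A.ft X) (D.ft_mem X hX) (by omega)
    exact ⟨A.comp (A.p X) f ((A.cod_p X).trans hd.symm), D.comp_mem _ (D.p_mem X hX) _ hf _,
      (A.dom_comp _ _ _).trans (A.dom_p X), (A.cod_comp _ _ _).trans hc⟩

/-- The C-system structure of a C-subsystem. -/
def CSubsystem.toCSystem {A : CSystem.{u}} (D : CSubsystem A) : CSystem.{u} where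
  Ob := D.ob
  Mor := D.mor
  dom f := ⟨A.dom f, D.dom_mem f f.2⟩
  cod f := ⟨A.cod f, D.cod_mem f f.2⟩
  id X := ⟨A.id X, D.id_mem X X.2⟩
  comp f g h := ⟨A.comp f g (congrArg Subtype.val h), D.comp_mem f f.2 g g.2 _⟩
  dom_id _ := Subtype.ext (A.dom_id _)
  cod_id _ := Subtype.ext (A.cod_id _)
  dom_comp _ _ _ := Subtype.ext (A.dom_comp _ _ _)
  cod_comp _ _ _ := Subtype.ext (A.cod_comp _ _ _)
  id_comp _ _ := Subtype.ext (A.id_comp _ _)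
  comp_id _ _ := Subtype.ext (A.comp_id _ _)
  assoc _ _ _ _ _ _ _ := Subtype.ext (A.assoc _ _ _ _ _ _ _)
  l X := A.l X
  pt := ⟨A.pt, D.pt_mem⟩
  ft X := ⟨A.ft X, D.ft_mem X X.2⟩
  p X := ⟨A.p X, D.p_mem X X.2⟩
  pull X f h hf := ⟨A.pull X f h (congrArg Subtype.val hf), D.pull_mem X X.2 f f.2 _ _⟩
  q X f h hf := ⟨A.q X f h (congrArg Subtype.val hf), D.q_mem X X.2 f f.2 _ _⟩
  s f h := ⟨A.s f h, D.s_mem f f.2 _⟩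
  l_eq_zero X := (A.l_eq_zero X).trans
    ⟨fun h => Subtype.ext h, fun h => congrArg Subtype.val h⟩
  l_ft X h := A.l_ft X h
  ft_pt := Subtype.ext A.ft_pt
  final X := by
    obtain ⟨f, hf, hd, hc⟩ := D.exists_final (A.l X) X X.2 rfl
    refine ⟨⟨f, hf⟩, ⟨Subtype.ext hd, Subtype.ext hc⟩, ?_⟩
    rintro ⟨g, hg⟩ ⟨h1, h2⟩
    exact Subtype.ext ((A.final X).unique
      ⟨congrArg Subtype.val h1, congrArg Subtype.val h2⟩ ⟨hd, hc⟩)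
  dom_p _ := Subtype.ext (A.dom_p _)
  cod_p _ := Subtype.ext (A.cod_p _)
  l_pull _ _ _ _ := A.l_pull _ _ _ _
  ft_pull _ _ _ _ := Subtype.ext (A.ft_pull _ _ _ _)
  dom_q _ _ _ _ := Subtype.ext (A.dom_q _ _ _ _)
  cod_q _ _ _ _ := Subtype.ext (A.cod_q _ _ _ _)
  q_comm _ _ _ _ _ _ := Subtype.ext (A.q_comm _ _ _ _ _ _)
  pull_id _ _ _ := Subtype.ext (A.pull_id _ _ _)
  q_id _ _ _ := Subtype.ext (A.q_id _ _ _)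
  pull_comp _ _ _ _ _ _ _ _ _ := Subtype.ext (A.pull_comp _ _ _ _ _ _ _ _ _)
  q_comp _ _ _ _ _ _ _ _ _ _ := Subtype.ext (A.q_comp _ _ _ _ _ _ _ _ _ _)
  dom_s _ _ := Subtype.ext (A.dom_s _ _)
  cod_s _ _ _ _ := Subtype.ext (A.cod_s _ _ _ _)
  s_p _ _ _ := Subtype.ext (A.s_p _ _ _)
  s_q _ _ _ _ _ := Subtype.ext (A.s_q _ _ _ _ _)
  s_pull _ _ _ _ _ _ _ _ h := Subtype.ext (A.s_pull _ _ _ _ _ _ _ _ (congrArg Subtype.val h))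

/-- A regular congruence relation on a C-system: equivalence relations on the objects and on the
morphisms that are compatible with all operations, preserve the length, and satisfy the two
lifting conditions that make the quotient a C-system. -/
structure RegularCongruence (A : CSystem.{u}) where
  ob : Setoid A.Ob
  mor : Setoid A.Mor
  dom_rel : ∀ f g, mor f g → ob (A.dom f) (A.dom g)
  cod_rel : ∀ f g, mor f g → ob (A.cod f) (A.cod g)
  id_rel : ∀ X Y, ob X Y → mor (A.id X) (A.id Y)
  ft_rel : ∀ X Y, ob X Y → ob (A.ft X) (A.ft Y)
  p_rel : ∀ X Y, ob X Y → mor (A.p X) (A.p Y)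
  comp_rel : ∀ f g f' g' h h', mor f f' → mor g g' → mor (A.comp f g h) (A.comp f' g' h')
  pull_rel : ∀ X f X' f' h hf h' hf', ob X X' → mor f f' →
    ob (A.pull X f h hf) (A.pull X' f' h' hf')
  q_rel : ∀ X f X' f' h hf h' hf', ob X X' → mor f f' →
    mor (A.q X f h hf) (A.q X' f' h' hf')
  s_rel : ∀ f f' h h', mor f f' → mor (A.s f h) (A.s f' h')
  l_eq : ∀ X Y, ob X Y → A.l X = A.l Y
  lift_ob : ∀ X F, 0 < A.l X → ob (A.ft X) F → ∃ X', ob X X' ∧ A.ft X' = F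
  lift_mor : ∀ f X' Y', ob (A.dom f) X' → ob (A.cod f) Y' →
    ∃ f', A.dom f' = X' ∧ A.cod f' = Y' ∧ mor f f'

/-! # Left modules over a monad on sets -/

/-- The map `bind f : R X ⟶ R X'` of a morphism `f : X ⟶ R X'`. -/
def bind {𝓒 : Type*} [Category 𝓒] (R : Monad 𝓒) {X X' : 𝓒} (f : X ⟶ R.obj X') :
    R.obj X ⟶ R.obj X' :=
  R.map f ≫ R.μ.app X'

/-- A left module over the monad `R`, with values in `𝓓`: a functor with an operation `ρ` that sends
`f : X ⟶ R X'` to `ρ f : LM X ⟶ LM X'` and is compatible with `η` and `bind`. -/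
structure LeftModule {𝓒 : Type*} [Category 𝓒] (R : Monad 𝓒) (𝓓 : Type*) [Category 𝓓]
    extends 𝓒 ⥤ 𝓓 where
  ρ : ∀ {X X' : 𝓒}, (X ⟶ R.obj X') → (obj X ⟶ obj X')
  ρ_η : ∀ X : 𝓒, ρ (R.η.app X) = 𝟙 (obj X)
  ρ_comp : ∀ {X X' X'' : 𝓒} (f : X ⟶ R.obj X') (g : X' ⟶ R.obj X''),
    ρ f ≫ ρ g = ρ (f ≫ bind R g)

section Expressions

variable {R : Monad (Type u)} (LM : LeftModule R (Type u))

variable (R) in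
/-- The set `R({1,…,n})` (variables are numbered from `0` here). -/
def Tm (n : ℕ) : Type u := R.obj (ULift.{u} (Fin n))

/-- The set `LM({1,…,n})`. -/
def Ty (n : ℕ) : Type u := LM.obj (ULift.{u} (Fin n))

/-- The `i`-th variable as an element of `R({1,…,n})`. -/
def Tm.var {n : ℕ} (i : Fin n) : Tm R n := R.η.app (ULift.{u} (Fin n)) ⟨i⟩

/-- A sequence in `R({1,…,m})` of length `n` as a morphism `{1,…,n} ⟶ R({1,…,m})`. -/
def toMap {n m : ℕ} (f : Fin n → Tm R m) : ULift.{u} (Fin n) ⟶ R.obj (ULift.{u} (Fin m)) :=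
  TypeCat.ofHom fun i => f i.down

/-- The simultaneous substitution `E(f₁/1,…,fₙ/n)` in `R`. -/
def Tm.subst {n m : ℕ} (f : Fin n → Tm R m) (E : Tm R n) : Tm R m := bind R (toMap f) E

variable {LM} in
/-- The simultaneous substitution `E(f₁/1,…,fₙ/n)` in `LM`. -/
def Ty.subst {n m : ℕ} (f : Fin n → Tm R m) (E : Ty LM n) : Ty LM m := LM.ρ (toMap f) E

theorem Tm.subst_var {n : ℕ} (E : Tm R n) : E.subst Tm.var = E := by
  have : toMap (Tm.var (R := R) (n := n)) = R.η.app _ := by ext; rfl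
  have h := R.right_unit (ULift.{u} (Fin n))
  rw [Tm.subst, this, bind, h]; rfl

theorem Tm.var_subst {n m : ℕ} (f : Fin n → Tm R m) (i : Fin n) :
    (Tm.var i).subst f = f i := by
  have h : R.η.app _ ≫ bind R (toMap f) = toMap f := by
    rw [bind, ← Category.assoc, ← Monad.unit_naturality, Category.assoc, R.left_unit]
    exact Category.comp_id (toMap f)
  exact congrArg (fun k => k ⟨i⟩) h

theorem bind_bind {𝓒 : Type*} [Category 𝓒] (R : Monad 𝓒) {X X' X'' : 𝓒} (f : X ⟶ R.obj X')
    (g : X' ⟶ R.obj X'') : bind R f ≫ bind R g = bind R (f ≫ bind R g) := by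
  simp only [bind, Functor.map_comp, Category.assoc]
  rw [R.assoc, ← Monad.mu_naturality_assoc]

theorem toMap_comp {n m k : ℕ} (f : Fin n → Tm R m) (g : Fin m → Tm R k) :
    toMap f ≫ bind R (toMap g) = toMap fun i => (f i).subst g := by
  ext; rfl

theorem Tm.subst_subst {n m k : ℕ} (f : Fin n → Tm R m) (g : Fin m → Tm R k) (E : Tm R n) :
    (E.subst f).subst g = E.subst fun i => (f i).subst g := by
  have h := bind_bind R (toMap f) (toMap g)
  rw [toMap_comp] at h
  exact congrArg (fun k => k E) h

variable {LM} in
theorem Ty.subst_var {n : ℕ} (E : Ty LM n) : E.subst Tm.var = E := by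
  have : toMap (Tm.var (R := R) (n := n)) = R.η.app _ := by ext; rfl
  rw [Ty.subst, this, LM.ρ_η]; rfl

variable {LM} in
theorem Ty.subst_subst {n m k : ℕ} (f : Fin n → Tm R m) (g : Fin m → Tm R k) (E : Ty LM n) :
    (E.subst f).subst g = E.subst fun i => (f i).subst g := by
  have h := LM.ρ_comp (toMap f) (toMap g)
  rw [toMap_comp] at h
  exact congrArg (fun k => k E) h

/-- The product `LM(∅) × ⋯ × LM({1,…,n-1})`: the sequences `(T₁,…,Tₙ)`. -/
inductive Ctx : ℕ → Type u
  | nil : Ctx 0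
  | snoc {n : ℕ} (Γ : Ctx n) (T : Ty LM n) : Ctx (n + 1)

/-- The product `LM({1,…,n}) × ⋯ × LM({1,…,n+k-1})`: the sequences of length `k` that can be
appended to a sequence `(T₁,…,Tₙ)`. -/
inductive Ext (n : ℕ) : ℕ → Type u
  | nil : Ext n 0
  | snoc {k : ℕ} (Δ : Ext n k) (T : Ty LM (n + k)) : Ext n (k + 1)

variable {LM} in
/-- The concatenation `(Γ, Δ)`. -/
def Ctx.append {n : ℕ} (Γ : Ctx LM n) : {k : ℕ} → Ext LM n k → Ctx LM (n + k)
  | _, .nil => Γ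
  | _, .snoc Δ T => .snoc (Γ.append Δ) T

/-- The objects of `CC(R, LM)`. -/
abbrev Obj : Type u := Σ n : ℕ, Ctx LM n

/-- The judgements `(Γ ⊢ o : S)`, written as triples `(Γ, S, o)`. -/
abbrev TObj : Type u := Σ n : ℕ, Ctx LM n × Ty LM n × Tm R n

/-- The set containing `Ceq`: the triples `(Γ, S, S')`. -/
abbrev ObjEq : Type u := Σ n : ℕ, Ctx LM n × Ty LM n × Ty LM n

/-- The set containing `C̃eq`: the quadruples `(Γ, S, o, o')`. -/
abbrev TObjEq : Type u := Σ n : ℕ, Ctx LM n × Ty LM n × Tm R n × Tm R n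

/-! # The C-system of a module -/

variable {LM}

/-- The map `ft`, deleting the last component. -/
def Obj.ft : Obj LM → Obj LM
  | ⟨_, .nil⟩ => ⟨0, .nil⟩
  | ⟨_, .snoc Γ _⟩ => ⟨_, Γ⟩

variable (LM) in
/-- The morphisms of `CC(R, LM)`: triples of two objects of lengths `m`, `n` and a sequence in
`R({1,…,m})` of length `n`. -/
structure Hom : Type u where
  dom : Obj LM
  cod : Obj LM
  map : Fin cod.1 → Tm R dom.1

theorem Hom.mk_congr {n m : ℕ} {Γ Γ' : Ctx LM n} {Δ Δ' : Ctx LM m} {f f' : Fin m → Tm R n}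
    (hΓ : Γ = Γ') (hΔ : Δ = Δ') (hf : f = f') :
    Hom.mk ⟨n, Γ⟩ ⟨m, Δ⟩ f = Hom.mk ⟨n, Γ'⟩ ⟨m, Δ'⟩ f' := by
  subst hΓ hΔ hf
  rfl

/-- The identity morphism `(1,…,n)`. -/
def Hom.id (X : Obj LM) : Hom LM := ⟨X, X, Tm.var⟩

/-- The composition of morphisms, in diagrammatic order. -/
def Hom.comp (f g : Hom LM) (h : f.cod = g.dom) : Hom LM :=
  ⟨f.dom, g.cod, fun i => (g.map i).subst fun j => f.map (j.cast (congrArg Sigma.fst h).symm)⟩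

/-- Inclusion `R({1,…,n}) → R({1,…,n+1})`. -/
def Tm.wk {n : ℕ} (E : Tm R n) : Tm R (n + 1) := E.subst fun i => Tm.var i.castSucc

/-- Inclusion `LM({1,…,n}) → LM({1,…,n+1})`. -/
def Ty.wk {n : ℕ} (E : Ty LM n) : Ty LM (n + 1) := E.subst fun i => Tm.var i.castSucc

/-- The sequence `(f₁,…,fₙ,r)`. -/
def snoc {n m : ℕ} (f : Fin n → Tm R m) (r : Tm R m) : Fin (n + 1) → Tm R m :=
  Fin.snoc (α := fun _ => Tm R m) f r

/-- The canonical projection `(1,…,n) : (T₁,…,Tₙ₊₁) ⟶ (T₁,…,Tₙ)`. -/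
def Hom.p : Obj LM → Hom LM
  | ⟨_, .nil⟩ => Hom.id ⟨0, .nil⟩
  | ⟨_, .snoc Γ T⟩ => ⟨⟨_, .snoc Γ T⟩, ⟨_, Γ⟩, fun i => Tm.var i.castSucc⟩

/-- The object `f^* X = (R₁,…,Rₘ,Tₙ₊₁(f₁/1,…,fₙ/n))`. -/
def Obj.pull : (X : Obj LM) → (f : Hom LM) → 0 < X.1 → f.cod = X.ft → Obj LM
  | ⟨_, .nil⟩, _, h, _ => absurd h (lt_irrefl 0)
  | ⟨_, .snoc _ T⟩, f, _, hf =>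
    ⟨_, f.dom.2.snoc (T.subst fun i => f.map (i.cast (congrArg Sigma.fst hf).symm))⟩

/-- The canonical morphism `(f₁,…,fₙ,m+1) : f^* X ⟶ X`. -/
def Hom.q : (X : Obj LM) → (f : Hom LM) → 0 < X.1 → f.cod = X.ft → Hom LM
  | ⟨_, .nil⟩, _, h, _ => absurd h (lt_irrefl 0)
  | ⟨_, .snoc Γ T⟩, f, _, hf =>
    ⟨⟨_, f.dom.2.snoc (T.subst fun i => f.map (i.cast (congrArg Sigma.fst hf).symm))⟩,
      ⟨_, .snoc Γ T⟩,
      snoc (fun i => (f.map (i.cast (congrArg Sigma.fst hf).symm)).wk) (Tm.var (Fin.last _))⟩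

/-- The section `(1,…,n,o) : Γ ⟶ (Γ, S)` corresponding to a judgement `(Γ ⊢ o : S)`. -/
def TObj.toHom (J : TObj LM) : Hom LM :=
  ⟨⟨J.1, J.2.1⟩, ⟨J.1 + 1, J.2.1.snoc J.2.2.1⟩, snoc Tm.var J.2.2.2⟩

/-- The section `s f` defined by a morphism `f = (f₁,…,fₙ₊₁) : Y ⟶ (T₁,…,Tₙ₊₁)`, namely the one
corresponding to `(Y ⊢ fₙ₊₁ : Tₙ₊₁(f₁/1,…,fₙ/n))`. -/
def Hom.s : (f : Hom LM) → 0 < f.cod.1 → Hom LM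
  | ⟨_, ⟨_, .nil⟩, _⟩, h => absurd h (lt_irrefl 0)
  | ⟨Y, ⟨_, .snoc _ T⟩, m⟩, _ =>
    TObj.toHom ⟨Y.1, Y.2, T.subst (fun i => m i.castSucc), m (Fin.last _)⟩

theorem snoc_castSucc {n m : ℕ} (f : Fin n → Tm R m) (r : Tm R m) (i : Fin n) :
    snoc f r i.castSucc = f i := by simp [snoc]

theorem snoc_last {n m : ℕ} (f : Fin n → Tm R m) (r : Tm R m) :
    snoc f r (Fin.last n) = r := by simp [snoc]

theorem Hom.comp_mk {X Y Z : Obj LM} (f : Fin Y.1 → Tm R X.1) (g : Fin Z.1 → Tm R Y.1) (h) :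
    Hom.comp ⟨X, Y, f⟩ ⟨Y, Z, g⟩ h = ⟨X, Z, fun i => (g i).subst f⟩ := rfl

theorem Hom.p_snoc {n : ℕ} (Γ : Ctx LM n) (T : Ty LM n) :
    Hom.p ⟨n + 1, Γ.snoc T⟩ = ⟨⟨n + 1, Γ.snoc T⟩, ⟨n, Γ⟩, fun i => Tm.var i.castSucc⟩ := rfl

theorem Obj.pull_mk {n : ℕ} (Γ : Ctx LM n) (T : Ty LM n) (X : Obj LM) (f : Fin n → Tm R X.1)
    (h hf) : Obj.pull ⟨n + 1, Γ.snoc T⟩ ⟨X, ⟨n, Γ⟩, f⟩ h hf =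
      ⟨X.1 + 1, X.2.snoc (T.subst f)⟩ := rfl

theorem Hom.q_mk {n : ℕ} (Γ : Ctx LM n) (T : Ty LM n) (X : Obj LM) (f : Fin n → Tm R X.1)
    (h hf) : Hom.q ⟨n + 1, Γ.snoc T⟩ ⟨X, ⟨n, Γ⟩, f⟩ h hf =
      ⟨⟨X.1 + 1, X.2.snoc (T.subst f)⟩, ⟨n + 1, Γ.snoc T⟩,
        snoc (fun i => (f i).wk) (Tm.var (Fin.last _))⟩ := rfl

theorem Hom.s_mk {n : ℕ} (Γ : Ctx LM n) (T : Ty LM n) (X : Obj LM)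
    (f : Fin (n + 1) → Tm R X.1) (h) : Hom.s ⟨X, ⟨n + 1, Γ.snoc T⟩, f⟩ h =
      ⟨X, ⟨X.1 + 1, X.2.snoc (T.subst fun i => f i.castSucc)⟩,
        snoc Tm.var (f (Fin.last _))⟩ := rfl

theorem snoc_subst {n m k : ℕ} (f : Fin n → Tm R m) (r : Tm R m) (g : Fin m → Tm R k) :
    (fun i => (snoc f r i).subst g) = snoc (fun i => (f i).subst g) (r.subst g) := by
  funext i
  refine Fin.lastCases ?_ (fun i => ?_) i
  · simp only [snoc_last]
  · simp only [snoc_castSucc]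

theorem snoc_self {n m : ℕ} (f : Fin (n + 1) → Tm R m) :
    snoc (fun i => f i.castSucc) (f (Fin.last n)) = f := by
  funext i
  refine Fin.lastCases ?_ (fun i => ?_) i
  · simp only [snoc_last]
  · simp only [snoc_castSucc]

theorem Tm.wk_subst {n m : ℕ} (E : Tm R n) (f : Fin (n + 1) → Tm R m) :
    E.wk.subst f = E.subst fun i => f i.castSucc := by
  simp only [Tm.wk, Tm.subst_subst, Tm.var_subst]

variable (LM) in
/-- The C-system `CC(R, LM)`. -/
def CC : CSystem.{u} where
  Ob := Obj LM
  Mor := Hom LM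
  dom := Hom.dom
  cod := Hom.cod
  id := Hom.id
  comp := Hom.comp
  dom_id _ := rfl
  cod_id _ := rfl
  dom_comp _ _ _ := rfl
  cod_comp _ _ _ := rfl
  id_comp := by
    rintro ⟨X, Y, f⟩ h
    exact congrArg (Hom.mk X Y) (funext fun i => Tm.subst_var (f i))
  comp_id := by
    rintro ⟨X, Y, f⟩ h
    exact congrArg (Hom.mk X Y) (funext fun i => Tm.var_subst f i)
  assoc := by
    rintro ⟨X, Y, f⟩ ⟨Y', Z, g⟩ ⟨Z', W, k⟩ h₁ h₂ h₃ h₄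
    dsimp only at h₁ h₃
    subst h₁ h₃
    exact congrArg (Hom.mk X W) (funext fun i => (Tm.subst_subst g f (k i)).symm)
  l X := X.1
  pt := ⟨0, .nil⟩
  ft := Obj.ft
  p := Hom.p
  pull := Obj.pull
  q := Hom.q
  s := Hom.s
  l_eq_zero := by
    rintro ⟨n, _ | _⟩ <;> simp
  l_ft := by
    rintro ⟨n, _ | _⟩ h
    · exact absurd h (lt_irrefl 0)
    · rfl
  ft_pt := rfl
  final := by
    intro X
    refine ⟨⟨X, ⟨0, .nil⟩, Fin.elim0⟩, ⟨rfl, rfl⟩, ?_⟩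
    rintro ⟨X', Y, f⟩ ⟨h₁, h₂⟩
    dsimp only at h₁ h₂
    subst h₁ h₂
    congr
    funext i
    exact i.elim0
  dom_p := by rintro ⟨n, _ | _⟩ <;> rfl
  cod_p := by rintro ⟨n, _ | _⟩ <;> rfl
  l_pull := by
    rintro ⟨n, _ | _⟩ f h hf
    · exact absurd h (lt_irrefl 0)
    · exact Nat.succ_pos _
  ft_pull := by
    rintro ⟨n, _ | _⟩ f h hf
    · exact absurd h (lt_irrefl 0)
    · rfl
  dom_q := by
    rintro ⟨n, _ | _⟩ f h hf
    · exact absurd h (lt_irrefl 0)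
    · rfl
  cod_q := by
    rintro ⟨n, _ | _⟩ f h hf
    · exact absurd h (lt_irrefl 0)
    · rfl
  q_comm := by
    rintro ⟨n, _ | ⟨Γ, T⟩⟩ ⟨X, Y, f⟩ h hf h₁ h₂
    · exact absurd h (lt_irrefl 0)
    · dsimp only [Obj.ft] at hf
      subst hf
      refine congrArg (Hom.mk ⟨X.1 + 1, X.2.snoc (T.subst f)⟩ ⟨_, Γ⟩) (funext fun i => ?_)
      exact (Tm.var_subst (snoc (fun j => (f j).wk) (Tm.var (Fin.last X.1))) i.castSucc).trans
        (snoc_castSucc (fun j => (f j).wk) (Tm.var (Fin.last X.1)) i)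
  pull_id := by
    rintro ⟨n, _ | ⟨Γ, T⟩⟩ h hf
    · exact absurd h (lt_irrefl 0)
    · exact congrArg (fun T' => (⟨_, Γ.snoc T'⟩ : Obj LM)) T.subst_var
  q_id := by
    rintro ⟨n, _ | ⟨Γ, T⟩⟩ h hf
    · exact absurd h (lt_irrefl 0)
    · refine Hom.mk_congr (congrArg Γ.snoc T.subst_var) rfl ?_
      refine Eq.trans ?_ (snoc_self Tm.var)
      exact congrArg (fun c => snoc c _) (funext fun i => Tm.var_subst _ i)
  pull_comp := by
    rintro ⟨n, _ | ⟨Γ, T⟩⟩ ⟨Y, Z, f⟩ ⟨X, Y', g⟩ hgf h h₁ h₂ h₃ h₄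
    · exact absurd h (lt_irrefl 0)
    · dsimp only [Obj.ft] at hgf h₂
      subst hgf h₂
      exact congrArg (fun T' => (⟨_, X.2.snoc T'⟩ : Obj LM)) (T.subst_subst f g).symm
  q_comp := by
    rintro ⟨n, _ | ⟨Γ, T⟩⟩ ⟨Y, Z, f⟩ ⟨X, Y', g⟩ hgf h h₁ h₂ h₃ h₄ h₅
    · exact absurd h (lt_irrefl 0)
    · dsimp only [Obj.ft] at hgf h₂
      subst hgf h₂
      refine Hom.mk_congr (congrArg X.2.snoc (T.subst_subst f g).symm) rfl ?_
      refine Eq.symm ((snoc_subst (fun i => (f i).wk) (Tm.var (Fin.last Y'.1))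
        (snoc (fun i => (g i).wk) (Tm.var (Fin.last X.1)))).trans ?_)
      simp only [Tm.wk_subst, Tm.var_subst, snoc_castSucc, snoc_last]
      simp only [Tm.wk, ← Tm.subst_subst]
      rfl
  dom_s := by
    rintro ⟨X, ⟨n, _ | ⟨Γ, T⟩⟩, f⟩ h
    · exact absurd h (lt_irrefl 0)
    · rfl
  cod_s := by
    rintro ⟨X, ⟨n, _ | ⟨Γ, T⟩⟩, f⟩ h h₁ h₂
    · exact absurd h (lt_irrefl 0)
    · exact congrArg (fun c => (⟨_, X.2.snoc (T.subst c)⟩ : Obj LM))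
        (funext fun i => (Tm.var_subst f i.castSucc).symm)
  s_p := by
    rintro ⟨X, ⟨n, _ | ⟨Γ, T⟩⟩, f⟩ h h₁
    · exact absurd h (lt_irrefl 0)
    · refine congrArg (Hom.mk X X) (funext fun i => ?_)
      exact (Tm.var_subst (snoc Tm.var (f (Fin.last _))) i.castSucc).trans
        (snoc_castSucc Tm.var (f (Fin.last _)) i)
  s_q := by
    rintro ⟨X, ⟨n, _ | ⟨Γ, T⟩⟩, f⟩ h h₁ h₂ h₃
    · exact absurd h (lt_irrefl 0)
    · simp only [Hom.s_mk, Hom.p_snoc, Hom.q_mk, Hom.comp_mk, Tm.var_subst, snoc_subst,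
        Tm.wk_subst, snoc_castSucc, snoc_last, Tm.subst_var, snoc_self]
  s_pull := by
    rintro ⟨X, Y, f⟩ ⟨n, _ | ⟨Γ, T⟩⟩ ⟨W, Z, g⟩ hU hg h h₁ h₂ hY
    · exact absurd hU (lt_irrefl 0)
    · dsimp only [Obj.ft, Obj.pull] at hg hY
      subst hg
      subst hY
      have key : (fun i => (snoc (fun i => (g i).wk) (Tm.var (Fin.last W.1)) i).subst f) =
          snoc (fun i => (g i).subst fun j => f j.castSucc) (f (Fin.last W.1)) := by
        simp only [snoc_subst, Tm.wk_subst, Tm.var_subst]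
      refine Eq.trans (b := Hom.s ⟨X, ⟨_ + 1, Γ.snoc T⟩,
        snoc (fun i => (g i).subst fun j => f j.castSucc) (f (Fin.last W.1))⟩ hU) ?_ ?_
      · simp only [Hom.s_mk, snoc_last]
        refine Hom.mk_congr rfl (congrArg X.2.snoc ((Ty.subst_subst _ _ _).trans ?_)) rfl
        exact congrArg (fun c => T.subst c) (funext fun i =>
          (snoc_castSucc (fun i => (g i).subst fun j => f j.castSucc) (f (Fin.last W.1)) i).symm)
      · simp only [← key]
        rfl

/-! # Weakening and substitution inside a context -/

/-- The renaming `t_{n+1}`: the first `n` variables are kept, the others are shifted up by one. -/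
def upIdx (n k : ℕ) (i : Fin (n + k)) : Fin (n + 1 + k) :=
  if i.1 < n then ⟨i.1, by omega⟩ else ⟨i.1 + 1, by omega⟩

/-- The substitution of `r` for the `(n+1)`-st variable; the first `n` variables are kept, the
last `k` variables are shifted down by one: `E ↦ s_{n+1}(E[r/n+1])`. -/
def instMap {n : ℕ} (r : Tm R n) (k : ℕ) (i : Fin (n + 1 + k)) : Tm R (n + k) :=
  if h : i.1 < n then Tm.var ⟨i.1, by omega⟩
  else if h' : i.1 = n then r.subst fun j => Tm.var (j.castAdd k)
  else Tm.var ⟨i.1 - 1, by omega⟩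

/-- `t_{n+1}` on `R({1,…,n+k})`. -/
def Tm.up {n k : ℕ} (E : Tm R (n + k)) : Tm R (n + 1 + k) := E.subst fun i => Tm.var (upIdx n k i)

/-- `t_{n+1}` on `LM({1,…,n+k})`. -/
def Ty.up {n k : ℕ} (E : Ty LM (n + k)) : Ty LM (n + 1 + k) :=
  E.subst fun i => Tm.var (upIdx n k i)

/-- `s_{n+1}(E[r/n+1])` for `E` in `R({1,…,n+1+k})`. -/
def Tm.inst {n k : ℕ} (E : Tm R (n + 1 + k)) (r : Tm R n) : Tm R (n + k) := E.subst (instMap r k)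

/-- `s_{n+1}(E[r/n+1])` for `E` in `LM({1,…,n+1+k})`. -/
def Ty.inst {n k : ℕ} (E : Ty LM (n + 1 + k)) (r : Tm R n) : Ty LM (n + k) :=
  E.subst (instMap r k)

/-- `t_{n+1}(Δ)`. -/
def Ext.up {n : ℕ} : {k : ℕ} → Ext LM n k → Ext LM (n + 1) k
  | _, .nil => .nil
  | _, .snoc Δ T => .snoc Δ.up T.up

/-- `s_{n+1}(Δ[r/n+1])`. -/
def Ext.inst {n : ℕ} (r : Tm R n) : {k : ℕ} → Ext LM (n + 1) k → Ext LM n k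
  | _, .nil => .nil
  | _, .snoc Δ T => .snoc (Δ.inst r) (T.inst r)

/-- `∂(Γ ⊢ o : S) = (Γ, S)`. -/
def TObj.bd (J : TObj LM) : Obj LM := ⟨J.1 + 1, J.2.1.snoc J.2.2.1⟩

/-! # The four kinds of judgements and the conditions on them -/

/-- `Γ ▷`. -/
def IsCtx (C : Set (Obj LM)) {n : ℕ} (Γ : Ctx LM n) : Prop := ⟨n, Γ⟩ ∈ C

/-- `Γ ⊢ o : S`. -/
def IsTm (C' : Set (TObj LM)) {n : ℕ} (Γ : Ctx LM n) (o : Tm R n) (S : Ty LM n) : Prop :=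
  ⟨n, Γ, S, o⟩ ∈ C'

/-- `Γ ⊢ S = S'`. -/
def EqTy (E : Set (ObjEq LM)) {n : ℕ} (Γ : Ctx LM n) (S S' : Ty LM n) : Prop :=
  ⟨n, Γ, S, S'⟩ ∈ E

/-- `Γ ⊢ o = o' : S`. -/
def EqTm (E' : Set (TObjEq LM)) {n : ℕ} (Γ : Ctx LM n) (o o' : Tm R n) (S : Ty LM n) : Prop :=
  ⟨n, Γ, S, o, o'⟩ ∈ E'

/-- The conditions on `(C, C̃)` that characterize C-subsystems of `CC(R, LM)`. -/
structure SubsystemConditions (C : Set (Obj LM)) (C' : Set (TObj LM)) : Prop where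
  empty : IsCtx C (Ctx.nil : Ctx LM 0)
  ft : ∀ {n} (Γ : Ctx LM n) (T : Ty LM n), IsCtx C (Γ.snoc T) → IsCtx C Γ
  bd : ∀ {n} (Γ : Ctx LM n) (r : Tm R n) (S : Ty LM n), IsTm C' Γ r S → IsCtx C (Γ.snoc S)
  weaken : ∀ {n k} (Γ : Ctx LM n) (T : Ty LM n) (Δ : Ext LM n k) (r : Tm R (n + k))
    (S : Ty LM (n + k)), IsCtx C (Γ.snoc T) → IsTm C' (Γ.append Δ) r S →
    IsTm C' ((Γ.snoc T).append Δ.up) r.up S.up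
  subst : ∀ {n k} (Γ : Ctx LM n) (s : Tm R n) (S : Ty LM n) (Δ : Ext LM (n + 1) k)
    (r : Tm R (n + 1 + k)) (T : Ty LM (n + 1 + k)), IsTm C' Γ s S →
    IsTm C' ((Γ.snoc S).append Δ) r T →
    IsTm C' (Γ.append (Δ.inst s)) (r.inst s) (T.inst s)
  var : ∀ {n} (Γ : Ctx LM n) (T : Ty LM n), IsCtx C (Γ.snoc T) →
    IsTm C' (Γ.snoc T) (Tm.var (Fin.last n)) T.wk

/-- The closure rules on the equality judgements: equivalence relations (`ty_*`, `tm_*`),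
conversion (`conv_*`), weakening (`weaken_*`), substitution (`subst_*`), congruence (`congr_*`). -/
structure EqualityConditions (C : Set (Obj LM)) (C' : Set (TObj LM)) (E : Set (ObjEq LM))
    (E' : Set (TObjEq LM)) : Prop where
  ty_left : ∀ {n} (Γ : Ctx LM n) (T T' : Ty LM n), EqTy E Γ T T' → IsCtx C (Γ.snoc T)
  ty_refl : ∀ {n} (Γ : Ctx LM n) (T : Ty LM n), IsCtx C (Γ.snoc T) → EqTy E Γ T T
  ty_symm : ∀ {n} (Γ : Ctx LM n) (T T' : Ty LM n), EqTy E Γ T T' → EqTy E Γ T' T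
  ty_trans : ∀ {n} (Γ : Ctx LM n) (T T' T'' : Ty LM n), EqTy E Γ T T' → EqTy E Γ T' T'' →
    EqTy E Γ T T''
  tm_left : ∀ {n} (Γ : Ctx LM n) (o o' : Tm R n) (T : Ty LM n), EqTm E' Γ o o' T → IsTm C' Γ o T
  tm_refl : ∀ {n} (Γ : Ctx LM n) (o : Tm R n) (T : Ty LM n), IsTm C' Γ o T → EqTm E' Γ o o T
  tm_symm : ∀ {n} (Γ : Ctx LM n) (o o' : Tm R n) (T : Ty LM n), EqTm E' Γ o o' T →
    EqTm E' Γ o' o T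
  tm_trans : ∀ {n} (Γ : Ctx LM n) (o o' o'' : Tm R n) (T : Ty LM n), EqTm E' Γ o o' T →
    EqTm E' Γ o' o'' T → EqTm E' Γ o o'' T
  conv_ty : ∀ {n k} (Γ : Ctx LM n) (T T' : Ty LM n) (Δ : Ext LM (n + 1) k)
    (S S' : Ty LM (n + 1 + k)), EqTy E Γ T T' → EqTy E ((Γ.snoc T).append Δ) S S' →
    EqTy E ((Γ.snoc T').append Δ) S S'
  conv_tm : ∀ {n k} (Γ : Ctx LM n) (T T' : Ty LM n) (Δ : Ext LM (n + 1) k)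
    (o o' : Tm R (n + 1 + k)) (S : Ty LM (n + 1 + k)), EqTy E Γ T T' →
    EqTm E' ((Γ.snoc T).append Δ) o o' S → EqTm E' ((Γ.snoc T').append Δ) o o' S
  conv : ∀ {n} (Γ : Ctx LM n) (S S' : Ty LM n) (o o' : Tm R n), EqTy E Γ S S' →
    EqTm E' Γ o o' S → EqTm E' Γ o o' S'
  weaken_ty : ∀ {n k} (Γ : Ctx LM n) (T : Ty LM n) (Δ : Ext LM n k) (S S' : Ty LM (n + k)),
    IsCtx C (Γ.snoc T) → EqTy E (Γ.append Δ) S S' →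
    EqTy E ((Γ.snoc T).append Δ.up) S.up S'.up
  weaken_tm : ∀ {n k} (Γ : Ctx LM n) (T : Ty LM n) (Δ : Ext LM n k) (o o' : Tm R (n + k))
    (S : Ty LM (n + k)), IsCtx C (Γ.snoc T) → EqTm E' (Γ.append Δ) o o' S →
    EqTm E' ((Γ.snoc T).append Δ.up) o.up o'.up S.up
  subst_ty : ∀ {n k} (Γ : Ctx LM n) (T : Ty LM n) (Δ : Ext LM (n + 1) k)
    (S S' : Ty LM (n + 1 + k)) (r : Tm R n), EqTy E ((Γ.snoc T).append Δ) S S' →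
    IsTm C' Γ r T → EqTy E (Γ.append (Δ.inst r)) (S.inst r) (S'.inst r)
  subst_tm : ∀ {n k} (Γ : Ctx LM n) (T : Ty LM n) (Δ : Ext LM (n + 1) k)
    (o o' : Tm R (n + 1 + k)) (S : Ty LM (n + 1 + k)) (r : Tm R n),
    EqTm E' ((Γ.snoc T).append Δ) o o' S → IsTm C' Γ r T →
    EqTm E' (Γ.append (Δ.inst r)) (o.inst r) (o'.inst r) (S.inst r)
  congr_ty : ∀ {n k} (Γ : Ctx LM n) (T : Ty LM n) (Δ : Ext LM (n + 1) k)
    (S : Ty LM (n + 1 + k)) (r r' : Tm R n), IsCtx C (((Γ.snoc T).append Δ).snoc S) →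
    EqTm E' Γ r r' T → EqTy E (Γ.append (Δ.inst r)) (S.inst r) (S.inst r')
  congr_tm : ∀ {n k} (Γ : Ctx LM n) (T : Ty LM n) (Δ : Ext LM (n + 1) k)
    (o : Tm R (n + 1 + k)) (S : Ty LM (n + 1 + k)) (r r' : Tm R n),
    IsTm C' ((Γ.snoc T).append Δ) o S → EqTm E' Γ r r' T →
    EqTm E' (Γ.append (Δ.inst r)) (o.inst r) (o.inst r') (S.inst r)

/-- The relation `∼` on `C`. -/
inductive Sim (C : Set (Obj LM)) (E : Set (ObjEq LM)) : Obj LM → Obj LM → Prop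
  | nil (h : IsCtx C (Ctx.nil : Ctx LM 0)) : Sim C E ⟨0, .nil⟩ ⟨0, .nil⟩
  | snoc {n : ℕ} {Γ Γ' : Ctx LM n} {T T' : Ty LM n} (h : IsCtx C (Γ.snoc T))
      (h' : IsCtx C (Γ'.snoc T')) (hΓ : Sim C E ⟨n, Γ⟩ ⟨n, Γ'⟩) (hT : EqTy E Γ T T') :
      Sim C E ⟨n + 1, Γ.snoc T⟩ ⟨n + 1, Γ'.snoc T'⟩

/-- The relation `≃` on `C̃`. -/
inductive Simeq (C : Set (Obj LM)) (C' : Set (TObj LM)) (E : Set (ObjEq LM))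
    (E' : Set (TObjEq LM)) : TObj LM → TObj LM → Prop
  | mk {n : ℕ} {Γ Γ' : Ctx LM n} {S S' : Ty LM n} {o o' : Tm R n} (h : IsTm C' Γ o S)
      (h' : IsTm C' Γ' o' S') (hS : Sim C E ⟨n + 1, Γ.snoc S⟩ ⟨n + 1, Γ'.snoc S'⟩)
      (ho : EqTm E' Γ o o' S) : Simeq C C' E E' ⟨n, Γ, S, o⟩ ⟨n, Γ', S', o'⟩

/-! # Regular congruence relations in terms of objects and sections -/

/-- The conditions under which a pair of equivalence relations `∼` on `C` and `≃` on `C̃` corresponds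
to a regular congruence relation: compatibility with `ft`, `∂` and the operations
`T`, `T̃`, `S`, `S̃`, `δ`, invariance of the length, and the lifting conditions for `ft`, `∂`. -/
structure RegularPair (C : Set (Obj LM)) (C' : Set (TObj LM)) (sim : Obj LM → Obj LM → Prop)
    (simeq : TObj LM → TObj LM → Prop) : Prop where
  ft : ∀ X Y, sim X Y → sim X.ft Y.ft
  bd : ∀ J J', simeq J J' → sim J.bd J'.bd
  weaken : ∀ {n k} (Γ Γ' : Ctx LM n) (T T' : Ty LM n) (Δ Δ' : Ext LM n k),
    sim ⟨_, Γ.snoc T⟩ ⟨_, Γ'.snoc T'⟩ → sim ⟨_, Γ.append Δ⟩ ⟨_, Γ'.append Δ'⟩ →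
    sim ⟨_, (Γ.snoc T).append Δ.up⟩ ⟨_, (Γ'.snoc T').append Δ'.up⟩
  weaken_tm : ∀ {n k} (Γ Γ' : Ctx LM n) (T T' : Ty LM n) (Δ Δ' : Ext LM n k)
    (S S' : Ty LM (n + k)) (o o' : Tm R (n + k)),
    sim ⟨_, Γ.snoc T⟩ ⟨_, Γ'.snoc T'⟩ →
    simeq ⟨_, Γ.append Δ, S, o⟩ ⟨_, Γ'.append Δ', S', o'⟩ →
    simeq ⟨_, (Γ.snoc T).append Δ.up, S.up, o.up⟩ ⟨_, (Γ'.snoc T').append Δ'.up, S'.up, o'.up⟩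
  subst : ∀ {n k} (Γ Γ' : Ctx LM n) (T T' : Ty LM n) (r r' : Tm R n) (Δ Δ' : Ext LM (n + 1) k),
    simeq ⟨_, Γ, T, r⟩ ⟨_, Γ', T', r'⟩ →
    sim ⟨_, (Γ.snoc T).append Δ⟩ ⟨_, (Γ'.snoc T').append Δ'⟩ →
    sim ⟨_, Γ.append (Δ.inst r)⟩ ⟨_, Γ'.append (Δ'.inst r')⟩
  subst_tm : ∀ {n k} (Γ Γ' : Ctx LM n) (T T' : Ty LM n) (r r' : Tm R n) (Δ Δ' : Ext LM (n + 1) k)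
    (S S' : Ty LM (n + 1 + k)) (o o' : Tm R (n + 1 + k)),
    simeq ⟨_, Γ, T, r⟩ ⟨_, Γ', T', r'⟩ →
    simeq ⟨_, (Γ.snoc T).append Δ, S, o⟩ ⟨_, (Γ'.snoc T').append Δ', S', o'⟩ →
    simeq ⟨_, Γ.append (Δ.inst r), S.inst r, o.inst r⟩
      ⟨_, Γ'.append (Δ'.inst r'), S'.inst r', o'.inst r'⟩
  var : ∀ {n} (Γ Γ' : Ctx LM n) (T T' : Ty LM n), sim ⟨_, Γ.snoc T⟩ ⟨_, Γ'.snoc T'⟩ →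
    simeq ⟨_, Γ.snoc T, T.wk, Tm.var (Fin.last n)⟩ ⟨_, Γ'.snoc T', T'.wk, Tm.var (Fin.last n)⟩
  length : ∀ X Y, sim X Y → X.1 = Y.1
  lift : ∀ X ∈ C, ∀ F ∈ C, 0 < X.1 → sim X.ft F → ∃ X' ∈ C, sim X X' ∧ X'.ft = F
  lift_tm : ∀ J ∈ C', ∀ F ∈ C, sim J.bd F → ∃ J' ∈ C', simeq J J' ∧ J'.bd = F

/-- The C-subsystem `D` of `CC(R, LM)` is the one defined by `(C, C̃)`: its objects are the elements
of `C` and its sections of canonical projections are the ones given by elements of `C̃`. -/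
def IsDefinedBy (D : CSubsystem (CC LM)) (C : Set (Obj LM)) (C' : Set (TObj LM)) : Prop :=
  D.ob = C ∧ D.mor ∩ (CC LM).sections = TObj.toHom '' C'

/-- The regular congruence relation `ρ` on `D` restricts to `∼` on objects and to `≃` on
sections of canonical projections. -/
def RestrictsTo {D : CSubsystem (CC LM)} (ρ : RegularCongruence D.toCSystem)
    (sim : Obj LM → Obj LM → Prop) (simeq : TObj LM → TObj LM → Prop) : Prop :=
  (∀ X Y : D.ob, ρ.ob X Y ↔ sim X.1 Y.1) ∧
    ∀ (f g : D.mor) (J J' : TObj LM), f.1 = J.toHom → g.1 = J'.toHom →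
      (ρ.mor f g ↔ simeq J J')

end Expressions

end ModCSys

namespace ModCSys

section Congruence

variable {R : CategoryTheory.Monad (Type u)} {LM : LeftModule R (Type u)}
  {C : Set (Obj LM)} {C' : Set (TObj LM)} {E : Set (ObjEq LM)} {E' : Set (TObjEq LM)}

/-! # Renaming and substitution of the last variable -/

/-! In a C-system a morphism `f` into `(Γ, T)` is the composite of its section `s_f` with the
canonical morphism `q` over the composite of `f` with the projection to `Γ`. Iterating, a morphism
`(f₁,…,fₙ) : Y ⟶ (T₁,…,Tₙ)` amounts to a list of judgements `Y ⊢ fᵢ₊₁ : Tᵢ₊₁(f₁/1,…,fᵢ/i)`. Objects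
and sections therefore determine a C-subsystem and a regular congruence relation on it. This gives
both uniqueness statements, and it dictates the definition for existence: two morphisms are equal
when their judgements are pairwise `≃` and their domains and codomains are `∼` (`MapSim`, `HomSim`).

For `∼` and `≃`, the asymmetric definition (equality is judged in the left context only) is repaired
by moving judgements between equal contexts. Equal contexts are joined by a chain of replacements of
one component (`Sim.steps`), and the conversion rules apply to each link. Compatibility with
substitution combines a substitution rule (`S[r] = S'[r]`) with a congruence rule (`S'[r] =
S'[r']`).

The main point is that simultaneous substitution along equal morphisms preserves `≃`, although the
hypotheses only cover weakening by one type and substitution of one term. The morphism `(f₁,…,fₙ,r)`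
is the substitution of `r` for the last variable followed by the lift of `(f₁,…,fₙ)` under one more
type, and a morphism to the empty context is a composite of weakenings. Since the rules allow an
arbitrary extension `Δ`, the composites of such pairs are stable under lifting (`Admissible.lift`),
so every `MapSim` pair is of this kind (`MapSim.admissible`) and preserves `≃` (`Admissible.simeq`).
All operations of the C-system then respect `HomSim`. The subsystem consists of the morphisms equal
to themselves, and its closure properties are the diagonal case of this compatibility. -/

theorem upIdx_zero (n : ℕ) : upIdx n 0 = Fin.castSucc := by
  funext i
  exact if_pos i.2

theorem Tm.up_zero {n : ℕ} (E : Tm R n) : Tm.up (k := 0) E = E.wk := by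
  simp only [Tm.up, upIdx_zero]
  rfl

theorem Ty.up_zero {n : ℕ} (E : Ty LM n) : Ty.up (k := 0) E = E.wk := by
  simp only [Ty.up, upIdx_zero]
  rfl

theorem Tm.subst_wk {n m : ℕ} (E : Tm R n) (f : Fin n → Tm R m) :
    (E.subst f).wk = E.subst fun i => (f i).wk :=
  Tm.subst_subst _ _ _

theorem Ty.subst_wk {n m : ℕ} (E : Ty LM n) (f : Fin n → Tm R m) :
    (E.subst f).wk = E.subst fun i => (f i).wk :=
  Ty.subst_subst _ _ _

/-- With no extension, substituting for the last variable is composition with the section given by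
`r`. -/
theorem instMap_zero {n : ℕ} (r : Tm R n) : instMap r 0 = snoc Tm.var r := by
  funext i
  refine Fin.lastCases ?_ (fun i => ?_) i
  · rw [snoc_last]
    have h : ¬ (Fin.last n : Fin (n + 1 + 0)).1 < n := lt_irrefl n
    have h' : (Fin.last n : Fin (n + 1 + 0)).1 = n := rfl
    rw [instMap, dif_neg h, dif_pos h']
    exact Tm.subst_var r
  · rw [snoc_castSucc]
    exact dif_pos i.2

/-- Lengthening the extension by one type turns the weakening into its lift `q`. With `instMap_succ`
this makes the generators of `Admissible` stable under lifting. -/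
theorem upIdx_succ (n k : ℕ) : (fun i => Tm.var (upIdx n (k + 1) i) : Fin (n + k + 1) → Tm R _) =
    snoc (fun i => (Tm.var (upIdx n k i)).wk) (Tm.var (Fin.last _)) := by
  funext i
  refine Fin.lastCases ?_ (fun i => ?_) i
  · rw [snoc_last]
    have h : ¬ (Fin.last (n + k) : Fin (n + (k + 1))).1 < n := by simp
    rw [upIdx, if_neg h]
    congr 1
    ext
    simp
    omega
  · rw [snoc_castSucc, Tm.wk, Tm.var_subst]
    congr 1
    ext
    simp only [upIdx, Fin.val_castSucc]
    split_ifs <;> rfl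

theorem instMap_succ {n : ℕ} (r : Tm R n) (k : ℕ) : instMap r (k + 1) =
    snoc (fun i => (instMap r k i).wk) (Tm.var (Fin.last _)) := by
  funext i
  refine Fin.lastCases (n := n + 1 + k) ?_ (fun i => ?_) i
  · rw [snoc_last]
    have h : ¬ (Fin.last (n + 1 + k) : Fin (n + 1 + (k + 1))).1 < n := by simp; omega
    have h' : ¬ (Fin.last (n + 1 + k) : Fin (n + 1 + (k + 1))).1 = n := by simp; omega
    rw [instMap, dif_neg h, dif_neg h']
    congr 1
    ext
    simp
  · rw [snoc_castSucc]
    simp only [instMap, Fin.val_castSucc]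
    split_ifs with h h'
    · rw [Tm.wk, Tm.var_subst]
      rfl
    · rw [Tm.subst_wk]
      simp only [Tm.wk, Tm.var_subst]
      rfl
    · rw [Tm.wk, Tm.var_subst]
      congr 1

/-! # Contexts under weakening and substitution -/

/-- The conditions weaken only term judgements. A context is recovered from one: weaken the
judgement on its last variable, then discard the term and its type. `subst_ctx` uses the same
device. -/
theorem SubsystemConditions.weaken_ctx (hC : SubsystemConditions C C') {n k : ℕ} {Γ : Ctx LM n}
    {T : Ty LM n} {Δ : Ext LM n k} (hT : IsCtx C (Γ.snoc T)) (hΔ : IsCtx C (Γ.append Δ)) :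
    IsCtx C ((Γ.snoc T).append Δ.up) := by
  cases Δ with
  | nil => exact hT
  | snoc Δ S => exact hC.ft _ _ (hC.bd _ _ _ (hC.weaken Γ T (Δ.snoc S) _ _ hT (hC.var _ _ hΔ)))

theorem SubsystemConditions.subst_ctx (hC : SubsystemConditions C C') {n k : ℕ} {Γ : Ctx LM n}
    {T : Ty LM n} {r : Tm R n} {Δ : Ext LM (n + 1) k} (hr : IsTm C' Γ r T)
    (hΔ : IsCtx C ((Γ.snoc T).append Δ)) : IsCtx C (Γ.append (Δ.inst r)) := by
  cases Δ with
  | nil => exact hC.ft _ _ hΔ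
  | snoc Δ S => exact hC.ft _ _ (hC.bd _ _ _ (hC.subst Γ r T (Δ.snoc S) _ _ hr (hC.var _ _ hΔ)))

/-! # Conversion of judgements along equal contexts -/

/-- `Γ'` is obtained from `Γ` by replacing one component by an equal one. -/
inductive Step (E : Set (ObjEq LM)) : {n : ℕ} → Ctx LM n → Ctx LM n → Prop
  | mk {n k : ℕ} (Γ : Ctx LM n) (T T' : Ty LM n) (Δ : Ext LM (n + 1) k) (h : EqTy E Γ T T') :
    Step E ((Γ.snoc T).append Δ) ((Γ.snoc T').append Δ)

theorem Step.snoc {n : ℕ} {Γ Γ' : Ctx LM n} (h : Step E Γ Γ') (U : Ty LM n) :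
    Step E (Γ.snoc U) (Γ'.snoc U) := by
  cases h with
  | mk Γ T T' Δ h => exact Step.mk Γ T T' (Δ.snoc U) h

theorem Sim.length {X Y : Obj LM} (h : Sim C E X Y) : X.1 = Y.1 := by
  cases h <;> rfl

theorem Sim.left {X Y : Obj LM} (h : Sim C E X Y) : X ∈ C := by
  cases h <;> assumption

theorem Sim.right {X Y : Obj LM} (h : Sim C E X Y) : Y ∈ C := by
  cases h <;> assumption

theorem Sim.ft {X Y : Obj LM} (h : Sim C E X Y) : Sim C E X.ft Y.ft := by
  cases h with
  | nil h => exact .nil h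
  | snoc h h' hΓ hT => exact hΓ

theorem Sim.init {n m : ℕ} {Γ : Ctx LM n} {Γ' : Ctx LM m} {T : Ty LM n} {T' : Ty LM m}
    (h : Sim C E ⟨n + 1, Γ.snoc T⟩ ⟨m + 1, Γ'.snoc T'⟩) : Sim C E ⟨n, Γ⟩ ⟨m, Γ'⟩ := h.ft

theorem Sim.eqTy {n : ℕ} {Γ Γ' : Ctx LM n} {T T' : Ty LM n}
    (h : Sim C E ⟨n + 1, Γ.snoc T⟩ ⟨n + 1, Γ'.snoc T'⟩) : EqTy E Γ T T' := by
  cases h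
  assumption

/-- The lengths of `X` and `Y` agree only propositionally, hence the transport. -/
theorem Sim.steps {X Y : Obj LM} (h : Sim C E X Y) :
    ∀ h' : Y.1 = X.1, Relation.ReflTransGen (Step E) X.2 (h' ▸ Y.2) := by
  induction h with
  | nil h => exact fun _ => .refl
  | @snoc n Γ Γ' T T' h h' hΓ hT ih =>
    intro _
    -- `T = T'` is judged over the unprimed `Γ`, so the last component must be replaced before the
    -- earlier ones.
    exact Relation.ReflTransGen.head (Step.mk Γ T T' .nil hT)
      (Relation.ReflTransGen.lift (p := Step E) (fun Θ : Ctx LM n => Θ.snoc T')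
        (fun _ _ hs => Step.snoc hs T') _ _ (ih rfl))

theorem Sim.transport {n : ℕ} {Γ Γ' : Ctx LM n} (P : Ctx LM n → Prop)
    (hP : ∀ Θ Θ', Step E Θ Θ' → P Θ → P Θ') (h : Sim C E ⟨n, Γ⟩ ⟨n, Γ'⟩) (hΓ : P Γ) : P Γ' := by
  have hs : Relation.ReflTransGen (Step E) Γ Γ' := h.steps rfl
  clear h
  induction hs with
  | refl => exact hΓ
  | tail _ hs ih => exact hP _ _ hs ih

namespace EqualityConditions

theorem eqTy_of_sim (hE : EqualityConditions C C' E E') {n : ℕ} {Γ Γ' : Ctx LM n}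
    {T T' : Ty LM n} (h : Sim C E ⟨n, Γ⟩ ⟨n, Γ'⟩) (hT : EqTy E Γ T T') : EqTy E Γ' T T' :=
  h.transport (fun Θ => EqTy E Θ T T')
    (fun _ _ hs hT => by
      cases hs with
      | mk Γ S S' Δ hS => exact hE.conv_ty _ _ _ _ _ _ hS hT) hT

theorem eqTm_of_sim (hE : EqualityConditions C C' E E') {n : ℕ} {Γ Γ' : Ctx LM n}
    {o o' : Tm R n} {T : Ty LM n} (h : Sim C E ⟨n, Γ⟩ ⟨n, Γ'⟩) (ho : EqTm E' Γ o o' T) :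
    EqTm E' Γ' o o' T :=
  h.transport (fun Θ => EqTm E' Θ o o' T)
    (fun _ _ hs ho => by
      cases hs with
      | mk Γ S S' Δ hS => exact hE.conv_tm _ _ _ _ _ _ _ hS ho) ho

/-- Conversion is postulated for equality judgements only. Well-formedness is moved by encoding it
as `T = T`, converting, and taking the left side; `tm_of_sim_snoc` does the same with `o = o`. -/
theorem ctx_of_sim (hE : EqualityConditions C C' E E') {n : ℕ} {Γ Γ' : Ctx LM n} {T : Ty LM n}
    (h : Sim C E ⟨n, Γ⟩ ⟨n, Γ'⟩) (hT : IsCtx C (Γ.snoc T)) : IsCtx C (Γ'.snoc T) :=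
  hE.ty_left _ _ _ (hE.eqTy_of_sim h (hE.ty_refl _ _ hT))

theorem eqTm_of_sim_snoc (hE : EqualityConditions C C' E E') {n : ℕ} {Γ Γ' : Ctx LM n}
    {o o' : Tm R n} {S S' : Ty LM n} (h : Sim C E ⟨n + 1, Γ.snoc S⟩ ⟨n + 1, Γ'.snoc S'⟩)
    (ho : EqTm E' Γ o o' S) : EqTm E' Γ' o o' S' :=
  hE.eqTm_of_sim h.init (hE.conv _ _ _ _ _ h.eqTy ho)

theorem tm_of_sim_snoc (hE : EqualityConditions C C' E E') {n : ℕ} {Γ Γ' : Ctx LM n}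
    {o : Tm R n} {S S' : Ty LM n} (h : Sim C E ⟨n + 1, Γ.snoc S⟩ ⟨n + 1, Γ'.snoc S'⟩)
    (ho : IsTm C' Γ o S) : IsTm C' Γ' o S' :=
  hE.tm_left _ _ _ _ (hE.eqTm_of_sim_snoc h (hE.tm_refl _ _ _ ho))

/-! ### The equivalence relations on contexts and on term judgements -/

theorem sim_refl (hC : SubsystemConditions C C') (hE : EqualityConditions C C' E E') {n : ℕ}
    {Γ : Ctx LM n} (h : IsCtx C Γ) : Sim C E ⟨n, Γ⟩ ⟨n, Γ⟩ := by
  induction Γ with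
  | nil => exact .nil h
  | snoc Γ T ih => exact .snoc h h (ih (hC.ft _ _ h)) (hE.ty_refl _ _ h)

theorem sim_symm (hE : EqualityConditions C C' E E') {X Y : Obj LM} (h : Sim C E X Y) :
    Sim C E Y X := by
  induction h with
  | nil h => exact .nil h
  | snoc h h' hΓ hT ih => exact .snoc h' h ih (hE.eqTy_of_sim hΓ (hE.ty_symm _ _ _ hT))

theorem sim_trans (hE : EqualityConditions C C' E E') {X Y Z : Obj LM} (h : Sim C E X Y)
    (h' : Sim C E Y Z) : Sim C E X Z := by
  induction h generalizing Z with
  | nil h => exact h'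
  | snoc h₁ h₂ hΓ hT ih =>
    cases h' with
    | snoc h₃ h₄ hΓ' hT' =>
      exact .snoc h₁ h₄ (ih hΓ')
        (hE.ty_trans _ _ _ _ hT (hE.eqTy_of_sim (hE.sim_symm hΓ) hT'))

end EqualityConditions

theorem Simeq.left {J J' : TObj LM} (h : Simeq C C' E E' J J') : J ∈ C' := by
  cases h; assumption

theorem Simeq.right {J J' : TObj LM} (h : Simeq C C' E E' J J') : J' ∈ C' := by
  cases h; assumption

theorem Simeq.bd {J J' : TObj LM} (h : Simeq C C' E E' J J') : Sim C E J.bd J'.bd := by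
  cases h; assumption

theorem Simeq.eqTm {n : ℕ} {Γ Γ' : Ctx LM n} {S S' : Ty LM n} {o o' : Tm R n}
    (h : Simeq C C' E E' ⟨n, Γ, S, o⟩ ⟨n, Γ', S', o'⟩) : EqTm E' Γ o o' S := by
  cases h; assumption

namespace EqualityConditions

theorem simeq_refl (hC : SubsystemConditions C C') (hE : EqualityConditions C C' E E')
    {J : TObj LM} (h : J ∈ C') : Simeq C C' E E' J J := by
  obtain ⟨n, Γ, S, o⟩ := J
  exact .mk h h (hE.sim_refl hC (hC.bd _ _ _ h)) (hE.tm_refl _ _ _ h)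

theorem simeq_symm (hE : EqualityConditions C C' E E') {J J' : TObj LM}
    (h : Simeq C C' E E' J J') : Simeq C C' E E' J' J := by
  cases h with
  | mk h h' hS ho =>
    exact .mk h' h (hE.sim_symm hS) (hE.eqTm_of_sim_snoc hS (hE.tm_symm _ _ _ _ ho))

theorem simeq_trans (hE : EqualityConditions C C' E E') {J J' J'' : TObj LM}
    (h : Simeq C C' E E' J J') (h' : Simeq C C' E E' J' J'') : Simeq C C' E E' J J'' := by
  cases h with
  | mk h₁ h₂ hS ho =>
    cases h' with
    | mk h₃ h₄ hS' ho' =>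
      exact .mk h₁ h₄ (hE.sim_trans hS hS')
        (hE.tm_trans _ _ _ _ _ ho (hE.eqTm_of_sim_snoc (hE.sim_symm hS) ho'))

theorem simeq_of_sim (hE : EqualityConditions C C' E E') {n : ℕ} {Γ Γ' : Ctx LM n}
    {S S' : Ty LM n} {o : Tm R n} (h : IsTm C' Γ o S)
    (hS : Sim C E ⟨n + 1, Γ.snoc S⟩ ⟨n + 1, Γ'.snoc S'⟩) :
    Simeq C C' E E' ⟨n, Γ, S, o⟩ ⟨n, Γ', S', o⟩ :=
  .mk h (hE.tm_of_sim_snoc hS h) hS (hE.tm_refl _ _ _ h)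

/-! # Compatibility with the operations -/

theorem sim_weaken (hC : SubsystemConditions C C') (hE : EqualityConditions C C' E E') {n k : ℕ}
    {Γ Γ' : Ctx LM n} {T T' : Ty LM n} {Δ Δ' : Ext LM n k}
    (hT : Sim C E ⟨_, Γ.snoc T⟩ ⟨_, Γ'.snoc T'⟩)
    (hΔ : Sim C E ⟨_, Γ.append Δ⟩ ⟨_, Γ'.append Δ'⟩) :
    Sim C E ⟨_, (Γ.snoc T).append Δ.up⟩ ⟨_, (Γ'.snoc T').append Δ'.up⟩ := by
  induction Δ with
  | nil => cases Δ'; exact hT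
  | @snoc k Δ S ih =>
    cases Δ' with
    | snoc Δ' S' =>
      have h : Sim C E ⟨_, (Γ.append Δ).snoc S⟩ ⟨_, (Γ'.append Δ').snoc S'⟩ := hΔ
      exact .snoc (hC.weaken_ctx (Δ := Δ.snoc S) hT.left hΔ.left)
        (hC.weaken_ctx (Δ := Δ'.snoc S') hT.right hΔ.right) (ih h.init)
        (hE.weaken_ty _ _ _ _ _ hT.left h.eqTy)

theorem simeq_weaken (hC : SubsystemConditions C C') (hE : EqualityConditions C C' E E')
    {n k : ℕ} {Γ Γ' : Ctx LM n} {T T' : Ty LM n} {Δ Δ' : Ext LM n k} {S S' : Ty LM (n + k)}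
    {o o' : Tm R (n + k)} (hT : Sim C E ⟨_, Γ.snoc T⟩ ⟨_, Γ'.snoc T'⟩)
    (h : Simeq C C' E E' ⟨_, Γ.append Δ, S, o⟩ ⟨_, Γ'.append Δ', S', o'⟩) :
    Simeq C C' E E' ⟨_, (Γ.snoc T).append Δ.up, S.up, o.up⟩
      ⟨_, (Γ'.snoc T').append Δ'.up, S'.up, o'.up⟩ :=
  .mk (hC.weaken _ _ _ _ _ hT.left h.left) (hC.weaken _ _ _ _ _ hT.right h.right)
    (hE.sim_weaken hC (Δ := Δ.snoc S) (Δ' := Δ'.snoc S') hT h.bd)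
    (hE.weaken_tm _ _ _ _ _ _ hT.left h.eqTm)

theorem sim_subst (hC : SubsystemConditions C C') (hE : EqualityConditions C C' E E') {n k : ℕ}
    {Γ Γ' : Ctx LM n} {T T' : Ty LM n} {r r' : Tm R n} {Δ Δ' : Ext LM (n + 1) k}
    (hr : Simeq C C' E E' ⟨_, Γ, T, r⟩ ⟨_, Γ', T', r'⟩)
    (hΔ : Sim C E ⟨_, (Γ.snoc T).append Δ⟩ ⟨_, (Γ'.snoc T').append Δ'⟩) :
    Sim C E ⟨_, Γ.append (Δ.inst r)⟩ ⟨_, Γ'.append (Δ'.inst r')⟩ := by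
  induction Δ with
  | nil => cases Δ'; exact hΔ.init
  | @snoc k Δ S ih =>
    cases Δ' with
    | snoc Δ' S' =>
      have h : Sim C E ⟨_, ((Γ.snoc T).append Δ).snoc S⟩ ⟨_, ((Γ'.snoc T').append Δ').snoc S'⟩ := hΔ
      refine .snoc (hC.subst_ctx (Δ := Δ.snoc S) hr.left hΔ.left)
        (hC.subst_ctx (Δ := Δ'.snoc S') hr.right hΔ.right) (ih h.init)
        -- The intermediate type is `S'[r]`. Both equalities live over `Γ, Δ[r]`, and the second
        -- needs `S'` well formed over the unprimed context, which is the right side of `S = S'`.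
        (hE.ty_trans _ _ _ _ (hE.subst_ty _ _ _ _ _ _ h.eqTy hr.left)
          (hE.congr_ty _ _ _ _ _ _ (hE.ty_left _ _ _ (hE.ty_symm _ _ _ h.eqTy)) hr.eqTm))

theorem simeq_subst (hC : SubsystemConditions C C') (hE : EqualityConditions C C' E E')
    {n k : ℕ} {Γ Γ' : Ctx LM n} {T T' : Ty LM n} {r r' : Tm R n} {Δ Δ' : Ext LM (n + 1) k}
    {S S' : Ty LM (n + 1 + k)} {o o' : Tm R (n + 1 + k)}
    (hr : Simeq C C' E E' ⟨_, Γ, T, r⟩ ⟨_, Γ', T', r'⟩)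
    (h : Simeq C C' E E' ⟨_, (Γ.snoc T).append Δ, S, o⟩ ⟨_, (Γ'.snoc T').append Δ', S', o'⟩) :
    Simeq C C' E E' ⟨_, Γ.append (Δ.inst r), S.inst r, o.inst r⟩
      ⟨_, Γ'.append (Δ'.inst r'), S'.inst r', o'.inst r'⟩ := by
  have hS : Sim C E ⟨_, Γ.append ((Δ.snoc S).inst r)⟩ ⟨_, Γ'.append ((Δ'.snoc S').inst r')⟩ :=
    hE.sim_subst hC hr h.bd
  refine .mk (hC.subst _ _ _ _ _ _ hr.left h.left) (hC.subst _ _ _ _ _ _ hr.right h.right) hS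
    (hE.tm_trans _ _ _ _ _ (hE.subst_tm _ _ _ _ _ _ _ h.eqTm hr.left) ?_)
  exact hE.congr_tm _ _ _ _ _ _ _ (hE.tm_left _ _ _ _ (hE.tm_symm _ _ _ _ h.eqTm)) hr.eqTm

theorem simeq_var (hC : SubsystemConditions C C') (hE : EqualityConditions C C' E E') {n : ℕ}
    {Γ Γ' : Ctx LM n} {T T' : Ty LM n} (h : Sim C E ⟨_, Γ.snoc T⟩ ⟨_, Γ'.snoc T'⟩) :
    Simeq C C' E E' ⟨_, Γ.snoc T, T.wk, Tm.var (Fin.last n)⟩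
      ⟨_, Γ'.snoc T', T'.wk, Tm.var (Fin.last n)⟩ := by
  have hv := hC.var _ _ h.left
  refine hE.simeq_of_sim hv ?_
  have hw : EqTy E (Γ.snoc T) (Ty.up (k := 0) T) (Ty.up (k := 0) T') :=
    hE.weaken_ty Γ T .nil T T' h.left h.eqTy
  rw [Ty.up_zero, Ty.up_zero] at hw
  exact .snoc (hC.bd _ _ _ hv) (hC.bd _ _ _ (hC.var _ _ h.right)) h hw

/-! ### The lifting conditions: the same type or term is kept over the new context -/

theorem exists_sim_ft (hE : EqualityConditions C C' E E') {X F : Obj LM} (hX : X ∈ C)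
    (hl : 0 < X.1) (h : Sim C E X.ft F) : ∃ X' ∈ C, Sim C E X X' ∧ X'.ft = F := by
  obtain ⟨n, _ | ⟨Γ, T⟩⟩ := X
  · exact absurd hl (lt_irrefl 0)
  · obtain ⟨m, Γ'⟩ := F
    obtain rfl : _ = m := h.length
    have hT := hE.ctx_of_sim h hX
    exact ⟨⟨_, Γ'.snoc T⟩, hT, .snoc hX hT h (hE.ty_refl _ _ hX), rfl⟩

theorem exists_simeq_bd (hE : EqualityConditions C C' E E') {J : TObj LM}
    {F : Obj LM} (hJ : J ∈ C') (h : Sim C E J.bd F) :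
    ∃ J' ∈ C', Simeq C C' E E' J J' ∧ J'.bd = F := by
  obtain ⟨n, Γ, S, o⟩ := J
  obtain ⟨m, _ | ⟨Γ', S'⟩⟩ := F
  · exact absurd h.length (Nat.succ_ne_zero _)
  · obtain rfl : n = _ := Nat.succ.inj h.length
    have := hE.simeq_of_sim hJ h
    exact ⟨_, this.right, this, rfl⟩

theorem regularPair (hC : SubsystemConditions C C') (hE : EqualityConditions C C' E E') :
    RegularPair C C' (Sim C E) (Simeq C C' E E') where
  ft _ _ h := h.ft
  bd _ _ h := h.bd
  weaken _ _ _ _ _ _ := hE.sim_weaken hC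
  weaken_tm _ _ _ _ _ _ _ _ _ _ := hE.simeq_weaken hC
  subst _ _ _ _ _ _ _ _ := hE.sim_subst hC
  subst_tm _ _ _ _ _ _ _ _ _ _ _ _ := hE.simeq_subst hC
  var _ _ _ _ := hE.simeq_var hC
  length _ _ h := h.length
  lift _ hX _ _ := hE.exists_sim_ft hX
  lift_tm _ hJ _ _ := hE.exists_simeq_bd hJ

end EqualityConditions

/-! # Simultaneous substitution -/

/-- The morphism `(f₁,…,fₙ,m+1) : (Γ, T(f₁/1,…,fₙ/n)) ⟶ (Δ, T)` given by
`f = (f₁,…,fₙ) : Γ ⟶ Δ`. -/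
def Hom.lift (f : Hom LM) (T : Ty LM f.cod.1) : Hom LM :=
  ⟨⟨f.dom.1 + 1, f.dom.2.snoc (T.subst f.map)⟩, ⟨f.cod.1 + 1, f.cod.2.snoc T⟩,
    snoc (fun i => (f.map i).wk) (Tm.var (Fin.last _))⟩

/-- The pairs of morphisms obtained by composing weakenings at equal types and substitutions of
equal terms, taken under arbitrary context extensions. -/
inductive Admissible (C : Set (Obj LM)) (C' : Set (TObj LM)) (E : Set (ObjEq LM))
    (E' : Set (TObjEq LM)) : Hom LM → Hom LM → Prop
  | id (X X' : Obj LM) : Admissible C C' E E' (Hom.id X) (Hom.id X')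
  | weaken {n k : ℕ} {Γ Γ' : Ctx LM n} {T T' : Ty LM n} (Δ Δ' : Ext LM n k)
    (hT : Sim C E ⟨_, Γ.snoc T⟩ ⟨_, Γ'.snoc T'⟩) :
    Admissible C C' E E'
      ⟨⟨_, (Γ.snoc T).append Δ.up⟩, ⟨_, Γ.append Δ⟩, fun i => Tm.var (upIdx n k i)⟩
      ⟨⟨_, (Γ'.snoc T').append Δ'.up⟩, ⟨_, Γ'.append Δ'⟩, fun i => Tm.var (upIdx n k i)⟩
  | subst {n k : ℕ} {Γ Γ' : Ctx LM n} {T T' : Ty LM n} {r r' : Tm R n} (Δ Δ' : Ext LM (n + 1) k)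
    (hr : Simeq C C' E E' ⟨_, Γ, T, r⟩ ⟨_, Γ', T', r'⟩) :
    Admissible C C' E E'
      ⟨⟨_, Γ.append (Δ.inst r)⟩, ⟨_, (Γ.snoc T).append Δ⟩, instMap r k⟩
      ⟨⟨_, Γ'.append (Δ'.inst r')⟩, ⟨_, (Γ'.snoc T').append Δ'⟩, instMap r' k⟩
  | comp {X Y Z X' Y' Z' : Obj LM} {f : Fin Y.1 → Tm R Z.1} {f' : Fin Y'.1 → Tm R Z'.1}
    {g : Fin X.1 → Tm R Y.1} {g' : Fin X'.1 → Tm R Y'.1}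
    (hf : Admissible C C' E E' ⟨Z, Y, f⟩ ⟨Z', Y', f'⟩)
    (hg : Admissible C C' E E' ⟨Y, X, g⟩ ⟨Y', X', g'⟩) :
    Admissible C C' E E' ⟨Z, X, fun i => (g i).subst f⟩ ⟨Z', X', fun i => (g' i).subst f'⟩

theorem snoc_var (n : ℕ) : snoc (fun i => (Tm.var i).wk) (Tm.var (Fin.last n)) =
    (Tm.var : Fin (n + 1) → Tm R (n + 1)) := by
  simp only [Tm.wk, Tm.var_subst]
  exact snoc_self _

theorem Hom.lift_id (X : Obj LM) (T : Ty LM X.1) :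
    (Hom.id X).lift T = Hom.id ⟨X.1 + 1, X.2.snoc T⟩ :=
  Hom.mk_congr (congrArg X.2.snoc T.subst_var) rfl (snoc_var _)

theorem Hom.lift_comp {X Y Z : Obj LM} (f : Fin Y.1 → Tm R Z.1) (g : Fin X.1 → Tm R Y.1)
    (T : Ty LM X.1) : Hom.lift ⟨Z, X, fun i => (g i).subst f⟩ T =
      ⟨(Hom.lift ⟨Z, Y, f⟩ (T.subst g)).dom, ⟨X.1 + 1, X.2.snoc T⟩,
        fun i => ((Hom.lift ⟨Y, X, g⟩ T).map i).subst
          (Hom.lift ⟨Z, Y, f⟩ (T.subst g)).map⟩ := by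
  refine Hom.mk_congr (congrArg Z.2.snoc (T.subst_subst g f).symm) rfl ?_
  simp only [Hom.lift, snoc_subst, Tm.wk_subst, Tm.var_subst, snoc_castSucc, snoc_last,
    Tm.subst_wk]

/-- The generators carry an arbitrary extension, so lifting one just appends `T` to it. No
well-formedness of `T` is asked: `Admissible` leaves the extensions unconstrained. -/
theorem Admissible.lift {f f' : Hom LM} (h : Admissible C C' E E' f f') :
    ∀ (T : Ty LM f.cod.1) (T' : Ty LM f'.cod.1),
      Admissible C C' E E' (f.lift T) (f'.lift T') := by
  induction h with
  | id X X' =>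
    intro T T'
    exact (congrArg₂ (Admissible C C' E E') (Hom.lift_id X T) (Hom.lift_id X' T')).mpr (.id _ _)
  | @weaken n k Γ Γ' U U' Δ Δ' hU =>
    intro T T'
    have := Admissible.weaken (C' := C') (E' := E') (Δ.snoc T) (Δ'.snoc T') hU
    exact (congrArg₂ (Admissible C C' E E') (congrArg (Hom.mk _ _) (upIdx_succ n k))
      (congrArg (Hom.mk _ _) (upIdx_succ n k))).mp this
  | @subst n k Γ Γ' U U' r r' Δ Δ' hr =>
    intro T T'
    have := Admissible.subst (Δ.snoc T) (Δ'.snoc T') hr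
    exact (congrArg₂ (Admissible C C' E E') (congrArg (Hom.mk _ _) (instMap_succ r k))
      (congrArg (Hom.mk _ _) (instMap_succ r' k))).mp this
  | comp hf hg ihf ihg =>
    intro T T'
    rw [Hom.lift_comp, Hom.lift_comp]
    exact .comp (ihf _ _) (ihg _ _)

/-- Each generator is covered by `simeq_weaken` or `simeq_subst`. The well-formedness that
`Admissible` does not record comes with the given `≃`. -/
theorem Admissible.simeq (hC : SubsystemConditions C C') (hE : EqualityConditions C C' E E')
    {f f' : Hom LM} (h : Admissible C C' E E' f f') :
    ∀ {S : Ty LM f.cod.1} {S' : Ty LM f'.cod.1} {o : Tm R f.cod.1} {o' : Tm R f'.cod.1},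
      Simeq C C' E E' ⟨_, f.cod.2, S, o⟩ ⟨_, f'.cod.2, S', o'⟩ →
      Simeq C C' E E' ⟨_, f.dom.2, S.subst f.map, o.subst f.map⟩
        ⟨_, f'.dom.2, S'.subst f'.map, o'.subst f'.map⟩ := by
  induction h with
  | id X X' =>
    intro S S' o o' h
    have key : ∀ (Z : Obj LM) (S : Ty LM Z.1) (o : Tm R Z.1),
        (⟨Z.1, Z.2, S.subst Tm.var, o.subst Tm.var⟩ : TObj LM) = ⟨Z.1, Z.2, S, o⟩ := by
      simp only [Ty.subst_var, Tm.subst_var, implies_true]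
    exact (congrArg₂ (Simeq C C' E E') (key X S o) (key X' S' o')).mpr h
  | weaken Δ Δ' hU => exact fun h => hE.simeq_weaken hC hU h
  | subst Δ Δ' hr => exact fun h => hE.simeq_subst hC hr h
  | comp hf hg ihf ihg =>
    intro S S' o o' h
    have := ihf (ihg h)
    simpa only [Ty.subst_subst, Tm.subst_subst] using this

/-! # Equality of morphisms -/

/-- Componentwise equality of two sequences of terms
`f = (f₁,…,fₙ) : Y ⟶ Γ`, `f' = (f₁',…,fₙ') : Y' ⟶ Γ'`. -/
inductive MapSim (C : Set (Obj LM)) (C' : Set (TObj LM)) (E : Set (ObjEq LM))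
    (E' : Set (TObjEq LM)) (Y Y' : Obj LM) :
    {n : ℕ} → Ctx LM n → Ctx LM n → (Fin n → Tm R Y.1) → (Fin n → Tm R Y'.1) → Prop
  | nil {f : Fin 0 → Tm R Y.1} {f' : Fin 0 → Tm R Y'.1} (h : Sim C E Y Y') :
    MapSim C C' E E' Y Y' .nil .nil f f'
  | snoc {n : ℕ} {Γ Γ' : Ctx LM n} {T T' : Ty LM n} {f : Fin (n + 1) → Tm R Y.1}
    {f' : Fin (n + 1) → Tm R Y'.1}
    (h : MapSim C C' E E' Y Y' Γ Γ' (fun i => f i.castSucc) (fun i => f' i.castSucc))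
    (hT : Sim C E ⟨n + 1, Γ.snoc T⟩ ⟨n + 1, Γ'.snoc T'⟩)
    (hr : Simeq C C' E E' ⟨Y.1, Y.2, T.subst fun i => f i.castSucc, f (Fin.last n)⟩
      ⟨Y'.1, Y'.2, T'.subst fun i => f' i.castSucc, f' (Fin.last n)⟩) :
    MapSim C C' E E' Y Y' (Γ.snoc T) (Γ'.snoc T') f f'

theorem snoc_comp_castSucc {n m : ℕ} (f : Fin n → Tm R m) (r : Tm R m) :
    (fun i => snoc f r i.castSucc) = f :=
  funext fun i => snoc_castSucc f r i

namespace MapSim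

variable {Y Y' : Obj LM} {n : ℕ} {Γ Γ' : Ctx LM n} {f : Fin n → Tm R Y.1} {f' : Fin n → Tm R Y'.1}

theorem mk_snoc {T T' : Ty LM n} {r : Tm R Y.1} {r' : Tm R Y'.1}
    (h : MapSim C C' E E' Y Y' Γ Γ' f f')
    (hT : Sim C E ⟨n + 1, Γ.snoc T⟩ ⟨n + 1, Γ'.snoc T'⟩)
    (hr : Simeq C C' E E' ⟨Y.1, Y.2, T.subst f, r⟩ ⟨Y'.1, Y'.2, T'.subst f', r'⟩) :
    MapSim C C' E E' Y Y' (Γ.snoc T) (Γ'.snoc T') (ModCSys.snoc f r) (ModCSys.snoc f' r') := by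
  refine .snoc ?_ hT ?_ <;> simpa only [snoc_comp_castSucc, snoc_last]

theorem snoc_iff {T T' : Ty LM n} {f : Fin (n + 1) → Tm R Y.1} {f' : Fin (n + 1) → Tm R Y'.1} :
    MapSim C C' E E' Y Y' (Γ.snoc T) (Γ'.snoc T') f f' ↔
      MapSim C C' E E' Y Y' Γ Γ' (fun i => f i.castSucc) (fun i => f' i.castSucc) ∧
      Sim C E ⟨n + 1, Γ.snoc T⟩ ⟨n + 1, Γ'.snoc T'⟩ ∧
      Simeq C C' E E' ⟨Y.1, Y.2, T.subst fun i => f i.castSucc, f (Fin.last n)⟩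
        ⟨Y'.1, Y'.2, T'.subst fun i => f' i.castSucc, f' (Fin.last n)⟩ := by
  constructor
  · intro h
    cases h with
    | snoc h hT hr => exact ⟨h, hT, hr⟩
  · rintro ⟨h, hT, hr⟩
    exact .snoc h hT hr

/-- Equality of the domains is stored at the `nil` end, so that it also holds for morphisms to the
empty context, which have no components. -/
theorem dom (h : MapSim C C' E E' Y Y' Γ Γ' f f') : Sim C E Y Y' := by
  induction h with
  | nil h => exact h
  | snoc h hT hr ih => exact ih

theorem cod (hC : SubsystemConditions C C') (h : MapSim C C' E E' Y Y' Γ Γ' f f') :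
    Sim C E ⟨n, Γ⟩ ⟨n, Γ'⟩ := by
  cases h with
  | nil h => exact .nil hC.empty
  | snoc h hT hr => exact hT

theorem symm (hE : EqualityConditions C C' E E') (h : MapSim C C' E E' Y Y' Γ Γ' f f') :
    MapSim C C' E E' Y' Y Γ' Γ f' f := by
  induction h with
  | nil h => exact .nil (hE.sim_symm h)
  | snoc h hT hr ih => exact .snoc ih (hE.sim_symm hT) (hE.simeq_symm hr)

theorem trans (hE : EqualityConditions C C' E E') {Y'' : Obj LM} {Γ'' : Ctx LM n}
    {f'' : Fin n → Tm R Y''.1} (h : MapSim C C' E E' Y Y' Γ Γ' f f')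
    (h' : MapSim C C' E E' Y' Y'' Γ' Γ'' f' f'') : MapSim C C' E E' Y Y'' Γ Γ'' f f'' := by
  induction h with
  | nil h =>
    cases h' with
    | nil h' => exact .nil (hE.sim_trans h h')
  | snoc h hT hr ih =>
    cases h' with
    | snoc h' hT' hr' => exact .snoc (ih h') (hE.sim_trans hT hT') (hE.simeq_trans hr hr')

theorem admissible_nil {X X' : Obj LM} (h : Sim C E X X') :
    ∀ (f : Fin 0 → Tm R X.1) (f' : Fin 0 → Tm R X'.1),
      Admissible C C' E E' ⟨X, ⟨0, .nil⟩, f⟩ ⟨X', ⟨0, .nil⟩, f'⟩ := by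
  induction h with
  | nil h =>
    intro f f'
    rw [Subsingleton.elim f Tm.var, Subsingleton.elim f' Tm.var]
    exact .id _ _
  | @snoc n Γ Γ' T T' h h' hΓ hT ih =>
    intro f f'
    have := Admissible.comp
      (Admissible.weaken (C' := C') (E' := E') .nil .nil (.snoc h h' hΓ hT))
      (ih Fin.elim0 Fin.elim0)
    rw [Subsingleton.elim f, Subsingleton.elim f']
    exact this

theorem admissible (h : MapSim C C' E E' Y Y' Γ Γ' f f') :
    Admissible C C' E E' ⟨Y, ⟨n, Γ⟩, f⟩ ⟨Y', ⟨n, Γ'⟩, f'⟩ := by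
  induction h with
  | nil h => exact admissible_nil h _ _
  | @snoc n Γ Γ' T T' f f' h hT hr ih =>
    obtain ⟨m, Δ⟩ := Y
    obtain ⟨m', Δ'⟩ := Y'
    obtain rfl : m = m' := h.dom.length
    -- The factorization is `Y ⟶ (Y, T(f₁,…,fₙ)) ⟶ (Γ, T)`: the section given by `fₙ₊₁`, then the
    -- lift of `(f₁,…,fₙ)`.
    have h₁ := Admissible.subst .nil .nil hr
    simp only [instMap_zero] at h₁
    have h₂ := Admissible.comp h₁ (ih.lift T T')
    have key : ∀ g : Fin (n + 1) → Tm R m,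
        (fun i => (ModCSys.snoc (fun i : Fin n => (g i.castSucc).wk)
          (Tm.var (Fin.last m)) i).subst (ModCSys.snoc Tm.var (g (Fin.last n)))) = g := by
      intro g
      rw [snoc_subst]
      simp only [Tm.wk_subst, snoc_castSucc, Tm.subst_var, Tm.var_subst, snoc_last]
      exact snoc_self g
    exact (congrArg₂ (Admissible C C' E E') (congrArg (Hom.mk ⟨m, Δ⟩ ⟨n + 1, Γ.snoc T⟩) (key f))
      (congrArg (Hom.mk ⟨m, Δ'⟩ ⟨n + 1, Γ'.snoc T'⟩) (key f'))).mp h₂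

theorem simeq_subst (hC : SubsystemConditions C C') (hE : EqualityConditions C C' E E')
    (h : MapSim C C' E E' Y Y' Γ Γ' f f') {S S' : Ty LM n} {o o' : Tm R n}
    (ho : Simeq C C' E E' ⟨n, Γ, S, o⟩ ⟨n, Γ', S', o'⟩) :
    Simeq C C' E E' ⟨Y.1, Y.2, S.subst f, o.subst f⟩ ⟨Y'.1, Y'.2, S'.subst f', o'.subst f'⟩ :=
  h.admissible.simeq hC hE ho

/-- `Admissible.simeq` speaks of term judgements only. Applied to the lifted pair and the last
variable of `(Γ, S)`, it yields a judgement whose context is the one wanted. -/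
theorem sim_subst (hC : SubsystemConditions C C') (hE : EqualityConditions C C' E E')
    (h : MapSim C C' E E' Y Y' Γ Γ' f f') {S S' : Ty LM n}
    (hS : Sim C E ⟨n + 1, Γ.snoc S⟩ ⟨n + 1, Γ'.snoc S'⟩) :
    Sim C E ⟨Y.1 + 1, Y.2.snoc (S.subst f)⟩ ⟨Y'.1 + 1, Y'.2.snoc (S'.subst f')⟩ :=
  ((h.admissible.lift S S').simeq hC hE (hE.simeq_var hC hS)).bd.init

theorem wk (hC : SubsystemConditions C C') (hE : EqualityConditions C C' E E')
    (h : MapSim C C' E E' Y Y' Γ Γ' f f') {U : Ty LM Y.1} {U' : Ty LM Y'.1}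
    (hU : Sim C E ⟨Y.1 + 1, Y.2.snoc U⟩ ⟨Y'.1 + 1, Y'.2.snoc U'⟩) :
    MapSim C C' E E' ⟨Y.1 + 1, Y.2.snoc U⟩ ⟨Y'.1 + 1, Y'.2.snoc U'⟩ Γ Γ'
      (fun i => (f i).wk) (fun i => (f' i).wk) := by
  induction h with
  | nil h => exact .nil hU
  | @snoc n Γ Γ' T T' f f' h hT hr ih =>
    refine .snoc ih hT ?_
    obtain ⟨m, Δ⟩ := Y
    obtain ⟨m', Δ'⟩ := Y'
    obtain rfl : m = m' := h.dom.length
    have := hE.simeq_weaken hC (Δ := .nil) (Δ' := .nil) hU hr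
    have e : ∀ g : Fin n → Tm R m, ∀ S : Ty LM n,
        Ty.up (k := 0) (S.subst g) = S.subst fun i => (g i).wk := fun g S => by
      rw [Ty.up_zero, Ty.subst_wk]
    have e' : ∀ r : Tm R m, Tm.up (k := 0) r = r.wk := Tm.up_zero
    have h₁ : Simeq C C' E E'
        ⟨m + 1, Δ.snoc U, Ty.up (k := 0) (T.subst fun i => f i.castSucc),
          Tm.up (k := 0) (f (Fin.last n))⟩
        ⟨m + 1, Δ'.snoc U', Ty.up (k := 0) (T'.subst fun i => f' i.castSucc),
          Tm.up (k := 0) (f' (Fin.last n))⟩ := this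
    rw [e, e, e', e'] at h₁
    exact h₁

theorem mk_q (hC : SubsystemConditions C C') (hE : EqualityConditions C C' E E')
    (h : MapSim C C' E E' Y Y' Γ Γ' f f') {T T' : Ty LM n}
    (hT : Sim C E ⟨n + 1, Γ.snoc T⟩ ⟨n + 1, Γ'.snoc T'⟩) :
    MapSim C C' E E' ⟨Y.1 + 1, Y.2.snoc (T.subst f)⟩ ⟨Y'.1 + 1, Y'.2.snoc (T'.subst f')⟩
      (Γ.snoc T) (Γ'.snoc T') (ModCSys.snoc (fun i => (f i).wk) (Tm.var (Fin.last _)))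
      (ModCSys.snoc (fun i => (f' i).wk) (Tm.var (Fin.last _))) := by
  have hT' := h.sim_subst hC hE hT
  refine (h.wk hC hE hT').mk_snoc hT ?_
  obtain ⟨m, Δ⟩ := Y
  obtain ⟨m', Δ'⟩ := Y'
  obtain rfl : m = m' := h.dom.length
  have := hE.simeq_var hC hT'
  simpa only [Ty.subst_wk] using this

theorem comp (hC : SubsystemConditions C C') (hE : EqualityConditions C C' E E')
    {m : ℕ} {Δ Δ' : Ctx LM m} {g : Fin m → Tm R n} {g' : Fin m → Tm R n}
    (h : MapSim C C' E E' Y Y' Γ Γ' f f')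
    (h' : MapSim C C' E E' ⟨n, Γ⟩ ⟨n, Γ'⟩ Δ Δ' g g') :
    MapSim C C' E E' Y Y' Δ Δ' (fun i => (g i).subst f) (fun i => (g' i).subst f') := by
  induction Δ with
  | nil => cases Δ'; exact .nil h.dom
  | snoc Δ T ih =>
    cases Δ' with
    | snoc Δ' T' =>
      obtain ⟨h', hT, hr⟩ := snoc_iff.1 h'
      refine .snoc (ih h') hT ?_
      have := h.simeq_subst hC hE hr
      simpa only [Ty.subst_subst] using this

/-- The identity of `(Γ, T)` is the lift of the identity of `Γ`. -/
theorem id (hC : SubsystemConditions C C') (hE : EqualityConditions C C' E E') {n : ℕ}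
    {Γ Γ' : Ctx LM n} (h : Sim C E ⟨n, Γ⟩ ⟨n, Γ'⟩) :
    MapSim C C' E E' ⟨n, Γ⟩ ⟨n, Γ'⟩ Γ Γ' Tm.var Tm.var := by
  induction Γ with
  | nil => cases Γ'; exact .nil h
  | @snoc n Γ T ih =>
    cases Γ' with
    | snoc Γ' T' =>
      have h' : MapSim C C' E E' ⟨n + 1, Γ.snoc (T.subst Tm.var)⟩ ⟨n + 1, Γ'.snoc (T'.subst Tm.var)⟩
          (Γ.snoc T) (Γ'.snoc T') (ModCSys.snoc (fun i => (Tm.var i).wk) (Tm.var (Fin.last n)))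
          (ModCSys.snoc (fun i => (Tm.var i).wk) (Tm.var (Fin.last n))) :=
        (ih h.init).mk_q hC hE h
      rw [snoc_var, Ty.subst_var, Ty.subst_var] at h'
      exact h'

/-- The same terms serve over the new contexts. Only the left judgements of `h` matter, so `Γ₁` and
`f₁` stay arbitrary. -/
theorem change (hC : SubsystemConditions C C') (hE : EqualityConditions C C' E E')
    {m n : ℕ} {Δ Δ' : Ctx LM m} {Γ₁ Γ Γ' : Ctx LM n} {f f₁ : Fin n → Tm R m}
    (hY : Sim C E ⟨m, Δ⟩ ⟨m, Δ'⟩) (hX : Sim C E ⟨n, Γ⟩ ⟨n, Γ'⟩)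
    (h : MapSim C C' E E' ⟨m, Δ⟩ ⟨m, Δ⟩ Γ Γ₁ f f₁) :
    MapSim C C' E E' ⟨m, Δ⟩ ⟨m, Δ'⟩ Γ Γ' f f := by
  induction Γ with
  | nil => cases Γ'; exact .nil hY
  | snoc Γ T ih =>
    cases Γ' with
    | snoc Γ' T' =>
      obtain _ | ⟨h, hT, hr⟩ := h
      have h' := ih hX.init h
      exact .snoc h' hX (hE.simeq_of_sim hr.left (h'.sim_subst hC hE hX))

end MapSim

/-- Equality of morphisms of `CC(R, LM)` derived from the equality judgements. -/
inductive HomSim (C : Set (Obj LM)) (C' : Set (TObj LM)) (E : Set (ObjEq LM))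
    (E' : Set (TObjEq LM)) : Hom LM → Hom LM → Prop
  | mk {Y Y' : Obj LM} {n : ℕ} {Γ Γ' : Ctx LM n} {f : Fin n → Tm R Y.1} {f' : Fin n → Tm R Y'.1}
    (h : MapSim C C' E E' Y Y' Γ Γ' f f') : HomSim C C' E E' ⟨Y, ⟨n, Γ⟩, f⟩ ⟨Y', ⟨n, Γ'⟩, f'⟩

/-! ### Compatibility of equality of morphisms with the operations of the C-system -/

namespace HomSim

theorem mapSim {Y Y' : Obj LM} {n : ℕ} {Γ Γ' : Ctx LM n} {f : Fin n → Tm R Y.1}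
    {f' : Fin n → Tm R Y'.1} (h : HomSim C C' E E' ⟨Y, ⟨n, Γ⟩, f⟩ ⟨Y', ⟨n, Γ'⟩, f'⟩) :
    MapSim C C' E E' Y Y' Γ Γ' f f' := by
  cases h with
  | mk h => exact h

theorem symm (hE : EqualityConditions C C' E E') {f g : Hom LM} (h : HomSim C C' E E' f g) :
    HomSim C C' E E' g f := by
  cases h with
  | mk h => exact .mk (h.symm hE)

theorem trans (hE : EqualityConditions C C' E E') {f g k : Hom LM} (h : HomSim C C' E E' f g)
    (h' : HomSim C C' E E' g k) : HomSim C C' E E' f k := by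
  cases h with
  | mk h =>
    cases h' with
    | mk h' => exact .mk (h.trans hE h')

theorem left (hE : EqualityConditions C C' E E') {f g : Hom LM} (h : HomSim C C' E E' f g) :
    HomSim C C' E E' f f := h.trans hE (h.symm hE)

theorem dom {f g : Hom LM} (h : HomSim C C' E E' f g) : Sim C E f.dom g.dom := by
  cases h with
  | mk h => exact h.dom

theorem cod (hC : SubsystemConditions C C') {f g : Hom LM} (h : HomSim C C' E E' f g) :
    Sim C E f.cod g.cod := by
  cases h with
  | mk h => exact h.cod hC

theorem id (hC : SubsystemConditions C C') (hE : EqualityConditions C C' E E') {X X' : Obj LM}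
    (h : Sim C E X X') : HomSim C C' E E' (Hom.id X) (Hom.id X') := by
  obtain ⟨n, Γ⟩ := X
  obtain ⟨n', Γ'⟩ := X'
  obtain rfl : n = n' := h.length
  exact .mk (MapSim.id hC hE h)

theorem p (hC : SubsystemConditions C C') (hE : EqualityConditions C C' E E') {X X' : Obj LM}
    (h : Sim C E X X') : HomSim C C' E E' (Hom.p X) (Hom.p X') := by
  cases h with
  | nil h => exact .id hC hE (.nil h)
  | @snoc n Γ Γ' T T' h h' hΓ hT =>
    have := (MapSim.id hC hE hΓ).wk hC hE (.snoc h h' hΓ hT)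
    simp only [Tm.wk, Tm.var_subst] at this
    exact .mk this

theorem comp (hC : SubsystemConditions C C') (hE : EqualityConditions C C' E E')
    {f f' g g' : Hom LM} (hf : HomSim C C' E E' f f') (hg : HomSim C C' E E' g g') (h h') :
    HomSim C C' E E' (Hom.comp f g h) (Hom.comp f' g' h') := by
  cases hf with
  | mk hf =>
    cases hg with
    | mk hg =>
      dsimp only at h h'
      subst h h'
      exact .mk (hf.comp hC hE hg)

theorem pull (hC : SubsystemConditions C C') (hE : EqualityConditions C C' E E')
    {X X' : Obj LM} {f f' : Hom LM} (hX : Sim C E X X') (hf : HomSim C C' E E' f f') (h h₁ h' h₁') :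
    Sim C E (Obj.pull X f h h₁) (Obj.pull X' f' h' h₁') := by
  cases hX with
  | nil _ => exact absurd h (lt_irrefl 0)
  | snoc hT hT' hΓ hTT' =>
    cases hf with
    | mk hf =>
      cases h₁
      cases h₁'
      exact hf.sim_subst hC hE (.snoc hT hT' hΓ hTT')

theorem q (hC : SubsystemConditions C C') (hE : EqualityConditions C C' E E')
    {X X' : Obj LM} {f f' : Hom LM} (hX : Sim C E X X') (hf : HomSim C C' E E' f f') (h h₁ h' h₁') :
    HomSim C C' E E' (Hom.q X f h h₁) (Hom.q X' f' h' h₁') := by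
  cases hX with
  | nil _ => exact absurd h (lt_irrefl 0)
  | snoc hT hT' hΓ hTT' =>
    cases hf with
    | mk hf =>
      cases h₁
      cases h₁'
      exact .mk (hf.mk_q hC hE (.snoc hT hT' hΓ hTT'))

theorem toHom_iff (hC : SubsystemConditions C C') (hE : EqualityConditions C C' E E')
    {J J' : TObj LM} : HomSim C C' E E' J.toHom J'.toHom ↔ Simeq C C' E E' J J' := by
  constructor
  · intro h
    obtain ⟨n, Γ, S, o⟩ := J
    obtain ⟨n', Γ', S', o'⟩ := J'
    obtain rfl : n = n' := h.dom.length
    have := (MapSim.snoc_iff.1 h.mapSim).2.2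
    simpa only [snoc_comp_castSucc, snoc_last, Ty.subst_var] using this
  · intro h
    cases h with
    | mk h h' hS ho =>
      refine .mk ((MapSim.id hC hE hS.init).mk_snoc hS ?_)
      simpa only [Ty.subst_var] using Simeq.mk h h' hS ho

theorem s (hC : SubsystemConditions C C') (hE : EqualityConditions C C' E E')
    {f f' : Hom LM} (hf : HomSim C C' E E' f f') (h h') :
    HomSim C C' E E' (Hom.s f h) (Hom.s f' h') := by
  cases hf with
  | mk hf =>
    cases hf with
    | nil _ => exact absurd h (lt_irrefl 0)
    | snoc hf hT hr => exact (toHom_iff hC hE).2 hr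

theorem exists_change (hC : SubsystemConditions C C') (hE : EqualityConditions C C' E E')
    {f : Hom LM} {X' Y' : Obj LM} (h : HomSim C C' E E' f f) (hX : Sim C E f.dom X')
    (hY : Sim C E f.cod Y') : ∃ f', f'.dom = X' ∧ f'.cod = Y' ∧ HomSim C C' E E' f f' := by
  obtain ⟨⟨m, Δ⟩, ⟨n, Γ⟩, f⟩ := f
  obtain ⟨m', Δ'⟩ := X'
  obtain ⟨n', Γ'⟩ := Y'
  obtain rfl : m = m' := hX.length
  obtain rfl : n = n' := hY.length
  exact ⟨⟨⟨m, Δ'⟩, ⟨n, Γ'⟩, f⟩, rfl, rfl, .mk (h.mapSim.change hC hE hX hY)⟩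

end HomSim

/-! # The C-subsystem -/

variable (E E') in
/-- The C-subsystem of `CC(R, LM)` whose morphisms are the ones equal to themselves. -/
def CSubsystem.ofConditions (hC : SubsystemConditions C C')
    (hE : EqualityConditions C C' E E') : CSubsystem (CC LM) where
  ob := C
  mor := {f | HomSim C C' E E' f f}
  dom_mem _ h := h.dom.left
  cod_mem _ h := (h.cod hC).left
  id_mem _ h := .id hC hE (hE.sim_refl hC h)
  comp_mem _ hf _ hg h := hf.comp hC hE hg h h
  pt_mem := hC.empty
  ft_mem X h := (hE.sim_refl hC h : Sim C E X X).ft.left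
  p_mem _ h := .p hC hE (hE.sim_refl hC h)
  pull_mem _ hX _ hf h h' := (hf.pull hC hE (hE.sim_refl hC hX) h h' h h').left
  q_mem _ hX _ hf _ _ := hf.q hC hE (hE.sim_refl hC hX) _ _ _ _
  s_mem _ hf _ := hf.s hC hE _ _

theorem TObj.toHom_mem_sections (J : TObj LM) : J.toHom ∈ (CC LM).sections := by
  refine ⟨Nat.succ_pos _, rfl, rfl, ?_⟩
  refine congrArg (Hom.mk _ _) (funext fun i => ?_)
  exact (Tm.var_subst _ _).trans (snoc_castSucc Tm.var J.2.2.2 i)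

theorem exists_toHom_eq {f : Hom LM} (h : f ∈ (CC LM).sections) :
    ∃ J : TObj LM, J.toHom = f := by
  obtain ⟨X, ⟨n, _ | ⟨Γ, T⟩⟩, f⟩ := f
  · exact absurd h.1 (lt_irrefl 0)
  · obtain ⟨_, hX, h₁, h₂⟩ := h
    obtain rfl : X = ⟨_, Γ⟩ := hX
    refine ⟨⟨_, Γ, T, f (Fin.last _)⟩, congrArg (Hom.mk _ _) ?_⟩
    -- The section equation says exactly that all entries but the last are the variables.
    have h₃ : (fun i : Fin _ => (Tm.var i.castSucc).subst f) = Tm.var := by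
      injection h₂
    simp only [Tm.var_subst] at h₃
    have := snoc_self f
    rw [h₃] at this
    exact this

theorem CSubsystem.ofConditions_isDefinedBy (hC : SubsystemConditions C C')
    (hE : EqualityConditions C C' E E') :
    IsDefinedBy (CSubsystem.ofConditions E E' hC hE) C C' := by
  refine ⟨rfl, Set.ext fun f => ⟨?_, ?_⟩⟩
  · rintro ⟨hf, hs⟩
    obtain ⟨J, rfl⟩ := exists_toHom_eq hs
    exact ⟨J, ((HomSim.toHom_iff hC hE).1 hf).left, rfl⟩
  · rintro ⟨J, hJ, rfl⟩
    exact ⟨(HomSim.toHom_iff hC hE).2 (hE.simeq_refl hC hJ), J.toHom_mem_sections⟩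

/-- A morphism to `(Γ, T)` is the composite of its section and of the canonical morphism over its
projection. -/
theorem Hom.s_comp_q {n : ℕ} {Γ : Ctx LM n} {T : Ty LM n} {Y : Obj LM}
    (f : Fin (n + 1) → Tm R Y.1) :
    Hom.comp (TObj.toHom ⟨Y.1, Y.2, T.subst fun i => f i.castSucc, f (Fin.last n)⟩)
      (Hom.q ⟨n + 1, Γ.snoc T⟩ ⟨Y, ⟨n, Γ⟩, fun i => f i.castSucc⟩ (Nat.succ_pos _) rfl) rfl =
      ⟨Y, ⟨n + 1, Γ.snoc T⟩, f⟩ := by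
  refine congrArg (Hom.mk _ _) ?_
  have : (fun i => (snoc (fun i : Fin n => (f i.castSucc).wk)
      (Tm.var (Fin.last Y.1)) i).subst (snoc Tm.var (f (Fin.last n)))) = f := by
    rw [snoc_subst]
    simp only [Tm.wk_subst, snoc_castSucc, Tm.subst_var, Tm.var_subst, snoc_last]
    exact snoc_self f
  exact this

theorem Hom.comp_p {n : ℕ} {Γ : Ctx LM n} {T : Ty LM n} {Y : Obj LM}
    (f : Fin (n + 1) → Tm R Y.1) :
    Hom.comp ⟨Y, ⟨n + 1, Γ.snoc T⟩, f⟩ (Hom.p ⟨n + 1, Γ.snoc T⟩) rfl =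
      ⟨Y, ⟨n, Γ⟩, fun i => f i.castSucc⟩ :=
  congrArg (Hom.mk _ _) (funext fun i => Tm.var_subst f i.castSucc)

/-! ### Uniqueness of the C-subsystem: its morphisms are determined by `C` and `C̃` -/

namespace IsDefinedBy

variable {D : CSubsystem (CC LM)}

theorem toHom_mem_iff (hD : IsDefinedBy D C C') {J : TObj LM} : J.toHom ∈ D.mor ↔ J ∈ C' := by
  constructor
  · intro h
    have h' : J.toHom ∈ TObj.toHom '' C' := hD.2 ▸ ⟨h, J.toHom_mem_sections⟩
    obtain ⟨J', hJ', e⟩ := h'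
    obtain ⟨n, Γ, S, o⟩ := J
    obtain ⟨n', Γ', S', o'⟩ := J'
    -- Membership in the image `TObj.toHom '' C'` gives `J ∈ C'` only because `TObj.toHom` is
    -- injective; the rest of this direction checks it.
    have ed : (⟨n', Γ'⟩ : Obj LM) = ⟨n, Γ⟩ := congrArg Hom.dom e
    cases ed
    injection e with _ e₂ e₃
    injection e₂ with _ e₂
    injection e₂ with _ _ e₂
    subst e₂
    have e₄ : snoc Tm.var o' (Fin.last n) = snoc Tm.var o (Fin.last n) := congrFun e₃ _
    rw [snoc_last, snoc_last] at e₄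
    subst e₄
    exact hJ'
  · intro h
    have h' : J.toHom ∈ D.mor ∩ (CC LM).sections := hD.2 ▸ ⟨J, h, rfl⟩
    exact h'.1

theorem castSucc_mem {n : ℕ} {Γ : Ctx LM n} {T : Ty LM n} {Y : Obj LM}
    {f : Fin (n + 1) → Tm R Y.1} (hf : (⟨Y, ⟨n + 1, Γ.snoc T⟩, f⟩ : Hom LM) ∈ D.mor) :
    (⟨Y, ⟨n, Γ⟩, fun i => f i.castSucc⟩ : Hom LM) ∈ D.mor := by
  have := D.comp_mem _ hf _ (D.p_mem _ (D.cod_mem _ hf)) rfl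
  exact Hom.comp_p f ▸ this

theorem homSim_of_mem (hC : SubsystemConditions C C') (hE : EqualityConditions C C' E E')
    (hD : IsDefinedBy D C C') {n : ℕ} {Γ : Ctx LM n} {Y : Obj LM} {f : Fin n → Tm R Y.1}
    (hf : (⟨Y, ⟨n, Γ⟩, f⟩ : Hom LM) ∈ D.mor) : MapSim C C' E E' Y Y Γ Γ f f := by
  induction Γ with
  | nil => exact .nil (hE.sim_refl hC (hD.1 ▸ D.dom_mem _ hf))
  | snoc Γ T ih =>
    exact .snoc (ih (castSucc_mem hf)) (hE.sim_refl hC (hD.1 ▸ D.cod_mem _ hf))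
      (hE.simeq_refl hC (hD.toHom_mem_iff.1 (D.s_mem _ hf (Nat.succ_pos _))))

/-- A morphism is rebuilt inside `D` from the morphism to the final object by repeatedly composing a
section from `C̃` with some `q`. -/
theorem mem_of_mapSim (hD : IsDefinedBy D C C') {n : ℕ}
    {Γ Γ' : Ctx LM n} {Y Y' : Obj LM}
    {f : Fin n → Tm R Y.1} {f' : Fin n → Tm R Y'.1} (h : MapSim C C' E E' Y Y' Γ Γ' f f') :
    (⟨Y, ⟨n, Γ⟩, f⟩ : Hom LM) ∈ D.mor := by
  induction h with
  | @nil f f' h =>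
    have hY : Y ∈ D.ob := hD.1 ▸ h.left
    obtain ⟨g, hg, hd, hc⟩ := D.exists_final _ Y hY rfl
    have e := ((CC LM).final Y).unique ⟨hd, hc⟩
      (y₂ := (⟨Y, ⟨0, .nil⟩, f⟩ : Hom LM)) ⟨rfl, rfl⟩
    exact e ▸ hg
  | @snoc n Γ Γ' T T' f f' h hT hr ih =>
    have hX : (⟨n + 1, Γ.snoc T⟩ : Obj LM) ∈ D.ob := hD.1 ▸ hT.left
    have := D.comp_mem _ (hD.toHom_mem_iff.2 hr.left) _
      (D.q_mem _ hX _ ih (Nat.succ_pos _) rfl) rfl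
    exact Hom.s_comp_q f ▸ this

theorem mem_iff (hC : SubsystemConditions C C') (hE : EqualityConditions C C' E E')
    (hD : IsDefinedBy D C C') {f : Hom LM} : f ∈ D.mor ↔ HomSim C C' E E' f f := by
  obtain ⟨Y, ⟨n, Γ⟩, f⟩ := f
  exact ⟨fun h => .mk (hD.homSim_of_mem hC hE h), fun h => hD.mem_of_mapSim h.mapSim⟩

end IsDefinedBy

theorem existsUnique_isDefinedBy (hC : SubsystemConditions C C')
    (hE : EqualityConditions C C' E E') : ∃! D : CSubsystem (CC LM), IsDefinedBy D C C' := by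
  have h₀ := CSubsystem.ofConditions_isDefinedBy hC hE
  refine ⟨_, h₀, fun D hD => CSubsystem.ext (hD.1.trans h₀.1.symm) (Set.ext fun f => ?_)⟩
  exact (hD.mem_iff hC hE).trans (h₀.mem_iff hC hE).symm

/-! # The regular congruence relation -/

/-- The regular congruence relation defined by `∼` and by the equality of morphisms. -/
def RegularCongruence.ofConditions (hC : SubsystemConditions C C')
    (hE : EqualityConditions C C' E E') {D : CSubsystem (CC LM)} (hD : IsDefinedBy D C C') :
    RegularCongruence D.toCSystem where
  ob :=
    { r := fun X Y => Sim C E X.1 Y.1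
      iseqv := ⟨fun X => hE.sim_refl hC (hD.1 ▸ X.2), hE.sim_symm, hE.sim_trans⟩ }
  mor :=
    { r := fun f g => HomSim C C' E E' f.1 g.1
      iseqv := ⟨fun f => (hD.mem_iff hC hE).1 f.2, HomSim.symm hE, HomSim.trans hE⟩ }
  dom_rel _ _ h := h.dom
  cod_rel _ _ h := h.cod hC
  id_rel _ _ h := .id hC hE h
  ft_rel _ _ h := h.ft
  p_rel _ _ h := .p hC hE h
  comp_rel _ _ _ _ h h' hf hg :=
    hf.comp hC hE hg (congrArg Subtype.val h) (congrArg Subtype.val h')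
  pull_rel _ _ _ _ _ _ _ _ hX hf := hf.pull hC hE hX _ _ _ _
  q_rel _ _ _ _ _ _ _ _ hX hf := hf.q hC hE hX _ _ _ _
  s_rel _ _ _ _ hf := hf.s hC hE _ _
  l_eq _ _ h := h.length
  lift_ob X F hl h := by
    obtain ⟨X', hX', hs, e⟩ := hE.exists_sim_ft (hD.1 ▸ X.2) hl h
    exact ⟨⟨X', hD.1 ▸ hX'⟩, hs, Subtype.ext e⟩
  lift_mor f X' Y' hX hY := by
    obtain ⟨f', hd, hc, hf⟩ := HomSim.exists_change hC hE ((hD.mem_iff hC hE).1 f.2) hX hY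
    exact ⟨⟨f', (hD.mem_iff hC hE).2 ((hf.symm hE).left hE)⟩, Subtype.ext hd, Subtype.ext hc, hf⟩

theorem RegularCongruence.ofConditions_restrictsTo (hC : SubsystemConditions C C')
    (hE : EqualityConditions C C' E E') {D : CSubsystem (CC LM)} (hD : IsDefinedBy D C C') :
    RestrictsTo (RegularCongruence.ofConditions hC hE hD) (Sim C E) (Simeq C C' E E') := by
  refine ⟨fun _ _ => Iff.rfl, ?_⟩
  rintro ⟨_, _⟩ ⟨_, _⟩ J J' rfl rfl
  exact HomSim.toHom_iff hC hE

theorem RegularCongruence.ext_rel {A : CSystem.{u}} {ρ σ : RegularCongruence A}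
    (hob : ∀ X Y, ρ.ob X Y ↔ σ.ob X Y) (hmor : ∀ f g, ρ.mor f g ↔ σ.mor f g) : ρ = σ := by
  have h₁ : ρ.ob = σ.ob := Setoid.ext hob
  have h₂ : ρ.mor = σ.mor := Setoid.ext hmor
  cases ρ
  cases σ
  dsimp only at h₁ h₂
  subst h₁ h₂
  rfl

/-! ### Uniqueness of the regular congruence relation -/

namespace RestrictsTo

variable {D : CSubsystem (CC LM)} {ρ : RegularCongruence D.toCSystem}

theorem rel_congr {f f' g g' : Hom LM} {hf : f ∈ D.mor} {hf' : f' ∈ D.mor} {hg : g ∈ D.mor}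
    {hg' : g' ∈ D.mor} (e : f = g) (e' : f' = g') (h : ρ.mor ⟨f, hf⟩ ⟨f', hf'⟩) :
    ρ.mor ⟨g, hg⟩ ⟨g', hg'⟩ := by
  subst e e'
  exact h

/-- A congruence respects `s` and composition with `p`, hence relates the sections of all
components; on sections it is `≃`. -/
theorem mapSim_of_rel (hρ : RestrictsTo ρ (Sim C E) (Simeq C C' E E')) {Y Y' : Obj LM} {n : ℕ}
    {Γ Γ' : Ctx LM n} {f : Fin n → Tm R Y.1} {f' : Fin n → Tm R Y'.1}
    (hf : (⟨Y, ⟨n, Γ⟩, f⟩ : Hom LM) ∈ D.mor) (hf' : (⟨Y', ⟨n, Γ'⟩, f'⟩ : Hom LM) ∈ D.mor)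
    (h : ρ.mor ⟨_, hf⟩ ⟨_, hf'⟩) : MapSim C C' E E' Y Y' Γ Γ' f f' := by
  induction Γ with
  | nil =>
    cases Γ'
    exact .nil ((hρ.1 _ _).1 (ρ.dom_rel _ _ h))
  | @snoc n Γ T ih =>
    cases Γ' with
    | snoc Γ' T' =>
      have hc := ρ.cod_rel _ _ h
      have hs := ρ.s_rel ⟨_, hf⟩ ⟨_, hf'⟩ (Nat.succ_pos _) (Nat.succ_pos _) h
      have hp := ρ.comp_rel _ _ _ _ rfl rfl h (ρ.p_rel _ _ hc)
      refine .snoc (ih (IsDefinedBy.castSucc_mem hf) (IsDefinedBy.castSucc_mem hf') ?_)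
        ((hρ.1 _ _).1 hc) ((hρ.2 _ _ _ _ rfl rfl).1 hs)
      have e₁ := Hom.comp_p (Γ := Γ) (T := T) f
      have e₂ := Hom.comp_p (Γ := Γ') (T := T') f'
      exact rel_congr e₁ e₂ hp

theorem rel_of_mapSim (hD : IsDefinedBy D C C')
    (hρ : RestrictsTo ρ (Sim C E) (Simeq C C' E E')) {Y Y' : Obj LM} {n : ℕ} {Γ Γ' : Ctx LM n} {f : Fin n → Tm R Y.1} {f' : Fin n → Tm R Y'.1}
    (h : MapSim C C' E E' Y Y' Γ Γ' f f') (hf : (⟨Y, ⟨n, Γ⟩, f⟩ : Hom LM) ∈ D.mor)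
    (hf' : (⟨Y', ⟨n, Γ'⟩, f'⟩ : Hom LM) ∈ D.mor) : ρ.mor ⟨_, hf⟩ ⟨_, hf'⟩ := by
  induction h with
  | @nil f f' h =>
    -- With no sections to compare, the lifting condition supplies some related morphism from `Y'`
    -- to the final object, which can only be `f'`.
    obtain ⟨g, hd, hc, hg⟩ := ρ.lift_mor ⟨_, hf⟩ ⟨Y', D.dom_mem _ hf'⟩ ⟨_, D.cod_mem _ hf'⟩
      ((hρ.1 _ _).2 h) (ρ.ob.refl _)
    have e := (D.toCSystem.final ⟨Y', D.dom_mem _ hf'⟩).unique ⟨hd, hc⟩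
      (y₂ := ⟨_, hf'⟩) ⟨rfl, rfl⟩
    exact e ▸ hg
  | @snoc n Γ Γ' T T' f f' h hT hr ih =>
    have h₁ := ih (IsDefinedBy.castSucc_mem hf) (IsDefinedBy.castSucc_mem hf')
    have hX : ρ.ob ⟨_, D.cod_mem _ hf⟩ ⟨_, D.cod_mem _ hf'⟩ := (hρ.1 _ _).2 hT
    have hq := ρ.q_rel ⟨_, D.cod_mem _ hf⟩ ⟨_, IsDefinedBy.castSucc_mem hf⟩
      ⟨_, D.cod_mem _ hf'⟩ ⟨_, IsDefinedBy.castSucc_mem hf'⟩ (Nat.succ_pos _) rfl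
      (Nat.succ_pos _) rfl hX h₁
    have hs := (hρ.2 ⟨_, hD.toHom_mem_iff.2 hr.left⟩ ⟨_, hD.toHom_mem_iff.2 hr.right⟩ _ _
      rfl rfl).2 hr
    have hc := ρ.comp_rel _ _ _ _ rfl rfl hs hq
    exact rel_congr (Hom.s_comp_q f) (Hom.s_comp_q f') hc

theorem mor_iff (hC : SubsystemConditions C C') (hD : IsDefinedBy D C C')
    (hρ : RestrictsTo ρ (Sim C E) (Simeq C C' E E')) (f g : D.mor) :
    ρ.mor f g ↔ HomSim C C' E E' f.1 g.1 := by
  obtain ⟨⟨Y, ⟨n, Γ⟩, f⟩, hf⟩ := f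
  obtain ⟨⟨Y', ⟨n', Γ'⟩, f'⟩, hf'⟩ := g
  constructor
  · intro h
    obtain rfl : n = n' := ρ.l_eq _ _ (ρ.cod_rel _ _ h)
    exact .mk (hρ.mapSim_of_rel hf hf' h)
  · intro h
    obtain rfl : n = n' := (h.cod hC).length
    exact hρ.rel_of_mapSim hD h.mapSim hf hf'

end RestrictsTo

theorem existsUnique_restrictsTo (hC : SubsystemConditions C C')
    (hE : EqualityConditions C C' E E') {D : CSubsystem (CC LM)} (hD : IsDefinedBy D C C') :
    ∃! ρ : RegularCongruence D.toCSystem,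
      RestrictsTo ρ (Sim C E) (Simeq C C' E E') := by
  refine ⟨_, RegularCongruence.ofConditions_restrictsTo hC hE hD, fun ρ hρ => ?_⟩
  exact RegularCongruence.ext_rel hρ.1 (hρ.mor_iff hC hD)

end Congruence

end ModCSys

theorem proposition2014p07p10 (R : CategoryTheory.Monad (Type u))
    (LM : ModCSys.LeftModule R (Type u))
    (C : Set (ModCSys.Obj LM)) (Ctilde : Set (ModCSys.TObj LM))
    (Ceq : Set (ModCSys.ObjEq LM)) (Ctildeeq : Set (ModCSys.TObjEq LM))
    (hC : ModCSys.SubsystemConditions C Ctilde)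
    (hCeq : ModCSys.EqualityConditions C Ctilde Ceq Ctildeeq) :
    Equivalence (fun X Y : C => ModCSys.Sim C Ceq X.1 Y.1) ∧
    Equivalence (fun J J' : Ctilde => ModCSys.Simeq C Ctilde Ceq Ctildeeq J.1 J'.1) ∧
    ModCSys.RegularPair C Ctilde (ModCSys.Sim C Ceq) (ModCSys.Simeq C Ctilde Ceq Ctildeeq) ∧
    (∃! D : ModCSys.CSubsystem (ModCSys.CC LM), ModCSys.IsDefinedBy D C Ctilde) ∧
    ∀ D : ModCSys.CSubsystem (ModCSys.CC LM), ModCSys.IsDefinedBy D C Ctilde →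
      ∃! ρ : ModCSys.RegularCongruence D.toCSystem,
        ModCSys.RestrictsTo ρ (ModCSys.Sim C Ceq) (ModCSys.Simeq C Ctilde Ceq Ctildeeq) := by
  refine ⟨⟨fun X => hCeq.sim_refl hC X.2, hCeq.sim_symm, hCeq.sim_trans⟩,
    ⟨fun J => hCeq.simeq_refl hC J.2, hCeq.simeq_symm, hCeq.simeq_trans⟩,
    hCeq.regularPair hC, ModCSys.existsUnique_isDefinedBy hC hCeq, fun D hD => ?_⟩
  exact ModCSys.existsUnique_restrictsTo hC hCeq hD
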